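/- Let $F=\mathbb Q(\alpha)$ and let $\Lambda_F=F[p_1,p_2,\dots]$ be the ring of symmetric functions over $F$ in infinitely many variables $x_1,x_2,\dots$, where $p_k=\sum_i x_i^k$. Let $m_\mu$ denote the monomial symmetric functions, $p_\mu=p_{\mu_1}p_{\mu_2}\cdots$, $\geq$ the dominance order on partitions of the same weight, and let $\langle\cdot,\cdot\rangle$ be the bilinear form on $\Lambda_F$ with $\langle p_\lambda,p_\mu\rangle=\delta_{\lambda\mu}\,\alpha^{l(\lambda)}z_\lambda$, where $l(\lambda)$ is the number of nonzero parts and $z_\lambda=\prod_i i^{m_i}m_i!$ with $m_i$ the multiplicity of $i$ in $\lambda$. The Jack functions $P_\lambda(\alpha)$ are defined by $$P_\lambda(\alpha)=\sum_{\mu\leq\lambda}c_{\lambda\mu}(\alpha)m_\mu,\quad c_{\lambda\mu}(\alpha)\in F,\ c_{\lambda\lambda}(\alpha)=1,\qquad \langle P_\lambda(\alpha),P_\mu(\alpha)\rangle=0\ \text{ for }\lambda\neq\mu,$$ and the dual Jack functions by $Q_\lambda(\alpha)=\langle P_\lambda,P_\lambda\rangle^{-1}P_\lambda(\alpha)$.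 Put $q_n=\sum_{\mu\vdash n}\alpha^{-l(\mu)}z_\mu^{-1}p_\mu$ and $q_\mu=q_{\mu_1}q_{\mu_2}\cdots$, and let $D(\alpha)$ be the linear operator $$D(\alpha)=\sum_{i,j\geq 1}(i+j)\alpha\, p_ip_j\frac{\partial}{\partial p_{i+j}}+\sum_{i,j\geq 1}ij\alpha^2 p_{i+j}\frac{\partial^2}{\partial p_i\partial p_j}+\alpha(\alpha-1)\sum_{k\geq 1}k^2p_k\frac{\partial}{\partial p_k}$$ on $\Lambda_F$, which preserves degree. **Theorem.** There is exactly one family $(P_\lambda(\alpha))_\lambda$, indexed by all partitions, that satisfies the defining properties of the Jack functions. For every partition $\lambda=(\lambda_1,\lambda_2,\dots)$ and every $Q'_\lambda\in\Lambda_F$, one has $Q'_\lambda=Q_\lambda(\alpha)$ if and only if both of the following hold: 1. there are $C_{\lambda\mu}(\alpha)\in F$ for $\mu\geq\lambda$, with $C_{\lambda\lambda}(\alpha)=1$, such that $Q'_\lambda=\sum_{\mu\geq\lambda}C_{\lambda\mu}(\alpha)\,q_\mu$; 2. $Q'_\lambda$ is an eigenvector of $D(\alpha)$. Moreover $D(\alpha)Q_\lambda(\alpha)=e_\lambda(\alpha)Q_\lambda(\alpha)$,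 where $$e_\lambda(\alpha)=\alpha^2\sum_i\lambda_i^2+\alpha\Big(|\lambda|-2\sum_i i\lambda_i\Big).$$ -/

import Mathlib

namespace Jack

/-- The field `ℚ(α)` of rational functions in the indeterminate `α`. -/
abbrev F : Type := RatFunc ℚ

/-- The indeterminate `α`. -/
noncomputable def α : F := RatFunc.X

/-! ### Partitions -/

/-- The set of all partitions (of all natural numbers, including the empty partition of `0`). -/
abbrev Ptn : Type := Σ n : ℕ, n.Partition

/-- The parts of a partition in weakly decreasing order, indexed from `0` and extended by zeros:
`part μ i` is `μ_{i+1}`. -/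
def part {n : ℕ} (μ : n.Partition) (i : ℕ) : ℕ :=
  (μ.parts.sort (· ≥ ·)).getD i 0

/-- Dominance order on partitions of the same weight: `Dominates μ ν` means `μ ≥ ν`. -/
def Dominates {n : ℕ} (μ ν : n.Partition) : Prop :=
  ∀ k : ℕ, ∑ i ∈ Finset.range k, part ν i ≤ ∑ i ∈ Finset.range k, part μ i

noncomputable instance {n : ℕ} : DecidableRel (Dominates (n := n)) := Classical.decRel _

/-- The length `l(μ)`, the number of nonzero parts. -/
def len {n : ℕ} (μ : n.Partition) : ℕ := Multiset.card μ.parts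

/-- `z_μ = ∏ i ^ m_i * m_i !`, where `m_i` is the multiplicity of the part `i` in `μ`. -/
def z {n : ℕ} (μ : n.Partition) : ℕ :=
  ∏ i ∈ μ.parts.toFinset, i ^ μ.parts.count i * (μ.parts.count i).factorial

/-! ### The ring of symmetric functions -/

/-- The ring of symmetric functions over `F`, written as the polynomial ring
`F[p₁, p₂, p₃, …]` in the power sums; the variable `MvPolynomial.X k` is `p_k`. -/
abbrev Sym : Type := MvPolynomial ℕ+ F

/-- The power sum `p_k = ∑ x_i ^ k` as a formal power series in infinitely many variables
`x_0, x_1, x_2, …`. -/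
noncomputable def powerSumSeries (k : ℕ+) : MvPowerSeries ℕ F := by
  classical
  exact fun d => if ∃ i : ℕ, d = Finsupp.single i (k : ℕ) then 1 else 0

/-- The algebra homomorphism which reads an element of `F[p₁, p₂, …]` as a symmetric function of
infinitely many variables `x_0, x_1, x_2, …`. -/
noncomputable def toSeries : Sym →ₐ[F] MvPowerSeries ℕ F :=
  MvPolynomial.aeval powerSumSeries

/-- The monomial symmetric function `m_μ`, the sum of all distinct monomials in
`x_0, x_1, x_2, …` whose multiset of nonzero exponents is `μ`. -/
noncomputable def monomialSymm {n : ℕ} (μ : n.Partition) : MvPowerSeries ℕ F := by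
  classical
  exact fun d => if d.support.val.map d = μ.parts then 1 else 0

/-- The power sum product `p_μ = p_{μ₁} p_{μ₂} ⋯`. -/
noncomputable def powerSum {n : ℕ} (μ : n.Partition) : Sym :=
  (μ.parts.map fun k => (MvPolynomial.X k.toPNat' : Sym)).prod

/-- The Jack scalar product on symmetric functions. The monomial in the `p_i` with exponents
`d = (d_i)` is `p_μ` for `μ = (1^{d₁} 2^{d₂} ⋯)`, and these monomials are pairwise orthogonal
with `⟨p_μ, p_μ⟩ = α ^ l(μ) * z_μ`, see `scalar_powerSum`. -/
noncomputable def scalar (f g : Sym) : F :=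
  ∑ d ∈ f.support, f.coeff d * g.coeff d *
    (α ^ (d.sum fun _ m => m) * d.prod fun i m => ((i : ℕ) : F) ^ m * (m.factorial : F))

/-! ### Jack functions -/

/-- The defining properties of the family `P_μ(α)` of Jack symmetric functions: `P_μ` is `m_μ`
plus a linear combination of the `m_ν` with `ν < μ` in the dominance order, and different members
of the family are orthogonal. -/
def IsJackFamily (P : Ptn → Sym) : Prop :=
  (∀ μ : Ptn, ∃ c : μ.1.Partition → F, c μ.2 = 1 ∧
    toSeries (P μ) = ∑ ν with Dominates μ.2 ν, c ν • monomialSymm ν) ∧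
  ∀ μ ν : Ptn, μ ≠ ν → scalar (P μ) (P ν) = 0

/-- The Jack symmetric functions `P_μ(α)`: the family with the property `IsJackFamily`. -/
noncomputable def jackP : Ptn → Sym := Classical.epsilon IsJackFamily

/-- The dual Jack function `Q_μ(α) = ⟨P_μ, P_μ⟩⁻¹ P_μ`. -/
noncomputable def jackQ (μ : Ptn) : Sym := (scalar (jackP μ) (jackP μ))⁻¹ • jackP μ

/-- The one-row function `q_n = ∑_{μ ⊢ n} α ^ (-l(μ)) z_μ⁻¹ p_μ`. -/
noncomputable def qRow (n : ℕ) : Sym :=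
  ∑ μ : n.Partition, ((α ^ len μ)⁻¹ * (z μ : F)⁻¹) • powerSum μ

/-- The generalized homogeneous symmetric function `q_μ = q_{μ₁} q_{μ₂} ⋯`. -/
noncomputable def q {n : ℕ} (μ : n.Partition) : Sym := (μ.parts.map qRow).prod

/-! ### The Laplace-Beltrami type operator -/

open MvPolynomial in
/-- The term `(i + j) α p_i p_j ∂/∂p_{i+j}`. -/
noncomputable def splitTerm (ij : ℕ+ × ℕ+) (f : Sym) : Sym :=
  (((ij.1 : ℕ) + (ij.2 : ℕ) : F) * α) • (X ij.1 * X ij.2 * pderiv (ij.1 + ij.2) f)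

open MvPolynomial in
/-- The term `i j α² p_{i+j} ∂²/∂p_i∂p_j`. -/
noncomputable def joinTerm (ij : ℕ+ × ℕ+) (f : Sym) : Sym :=
  (((ij.1 : ℕ) : F) * ((ij.2 : ℕ) : F) * α ^ 2) •
    (X (ij.1 + ij.2) * pderiv ij.1 (pderiv ij.2 f))

open MvPolynomial in
/-- The term `k² p_k ∂/∂p_k`. -/
noncomputable def diagTerm (k : ℕ+) (f : Sym) : Sym :=
  (((k : ℕ) : F) ^ 2) • (X k * pderiv k f)

theorem splitTerm_finite (f : Sym) : (Function.support fun ij => splitTerm ij f).Finite := by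
  classical
  refine (f.vars.biUnion fun n => Finset.Iic n ×ˢ Finset.Iic n).finite_toSet.subset ?_
  intro ij h
  have hm : ij.1 + ij.2 ∈ f.vars := by
    by_contra hc
    exact h (by simp [splitTerm, MvPolynomial.pderiv_eq_zero_of_notMem_vars hc])
  simp only [Finset.coe_biUnion, Set.mem_iUnion]
  refine ⟨ij.1 + ij.2, hm, ?_⟩
  simp only [Finset.coe_product, Set.mem_prod, Finset.coe_Iic, Set.mem_Iic]
  exact ⟨(PNat.lt_add_right _ _).le, (PNat.lt_add_left _ _).le⟩

theorem joinTerm_finite (f : Sym) : (Function.support fun ij => joinTerm ij f).Finite := by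
  classical
  refine (f.vars ×ˢ f.vars).finite_toSet.subset ?_
  intro ij h
  have hcomm : MvPolynomial.pderiv ij.1 (MvPolynomial.pderiv ij.2 f) =
      MvPolynomial.pderiv ij.2 (MvPolynomial.pderiv ij.1 f) := by
    have : ⁅(MvPolynomial.pderiv ij.1 : Derivation F Sym Sym), (MvPolynomial.pderiv ij.2 :
        Derivation F Sym Sym)⁆ = 0 := by
      apply MvPolynomial.derivation_ext
      intro k
      simp [Derivation.commutator_apply, MvPolynomial.pderiv_X, Pi.single_apply, apply_ite]
    have h2 := congrArg (fun A : Derivation F Sym Sym => A f) this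
    simpa [Derivation.commutator_apply, sub_eq_zero] using h2
  have h2 : ij.2 ∈ f.vars := by
    by_contra hc
    exact h (by simp [joinTerm, MvPolynomial.pderiv_eq_zero_of_notMem_vars hc])
  have h1 : ij.1 ∈ f.vars := by
    by_contra hc
    exact h (by simp [joinTerm, hcomm, MvPolynomial.pderiv_eq_zero_of_notMem_vars hc])
  simp [h1, h2]

theorem diagTerm_finite (f : Sym) : (Function.support fun k => diagTerm k f).Finite := by
  refine f.vars.finite_toSet.subset ?_
  intro k h
  by_contra hc
  exact h (by simp [diagTerm, MvPolynomial.pderiv_eq_zero_of_notMem_vars (by simpa using hc)])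

/-- The operator `D(α) = ∑ (i+j) α p_i p_j ∂/∂p_{i+j} + ∑ i j α² p_{i+j} ∂²/∂p_i∂p_j
+ α (α - 1) ∑ k² p_k ∂/∂p_k`, the sums running over all `i, j ≥ 1` and all `k ≥ 1`. Only finitely
many terms of each sum are nonzero on a given symmetric function, by the three lemmas above. -/
noncomputable def D : Module.End F Sym where
  toFun f := ∑ᶠ ij : ℕ+ × ℕ+, splitTerm ij f + ∑ᶠ ij : ℕ+ × ℕ+, joinTerm ij f +
    (α * (α - 1)) • ∑ᶠ k : ℕ+, diagTerm k f
  map_add' f g := by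
    have h1 : ∀ ij, splitTerm ij (f + g) = splitTerm ij f + splitTerm ij g := fun ij => by
      simp [splitTerm, mul_add]
    have h2 : ∀ ij, joinTerm ij (f + g) = joinTerm ij f + joinTerm ij g := fun ij => by
      simp [joinTerm, mul_add]
    have h3 : ∀ k, diagTerm k (f + g) = diagTerm k f + diagTerm k g := fun k => by
      simp [diagTerm, mul_add]
    simp only [h1, h2, h3]
    rw [finsum_add_distrib (splitTerm_finite f) (splitTerm_finite g),
      finsum_add_distrib (joinTerm_finite f) (joinTerm_finite g),
      finsum_add_distrib (diagTerm_finite f) (diagTerm_finite g), smul_add]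
    abel
  map_smul' c f := by
    have h1 : ∀ ij, splitTerm ij (c • f) = c • splitTerm ij f := fun ij => by
      simp only [splitTerm, Derivation.map_smul, mul_smul_comm]; rw [smul_comm]
    have h2 : ∀ ij, joinTerm ij (c • f) = c • joinTerm ij f := fun ij => by
      simp only [joinTerm, Derivation.map_smul, mul_smul_comm]; rw [smul_comm]
    have h3 : ∀ k, diagTerm k (c • f) = c • diagTerm k f := fun k => by
      simp only [diagTerm, Derivation.map_smul, mul_smul_comm]; rw [smul_comm]
    simp only [h1, h2, h3, ← smul_finsum, smul_add, RingHom.id_apply]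
    rw [smul_comm]

/-- The eigenvalue `e_μ(α) = α² ∑ μ_i² + α (|μ| - 2 ∑ i μ_i)`. -/
noncomputable def e {n : ℕ} (μ : n.Partition) : F :=
  α ^ 2 * ∑ i ∈ Finset.range (len μ), (part μ i : F) ^ 2 +
    α * ((n : F) - 2 * ∑ i ∈ Finset.range (len μ), ((i : F) + 1) * (part μ i : F))

/-! ### The scalar product on the power sum basis -/

theorem powerSum_eq_monomial {n : ℕ} (μ : n.Partition) :
    powerSum μ = MvPolynomial.monomial (Multiset.toFinsupp (μ.parts.map Nat.toPNat')) 1 := by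
  classical
  unfold powerSum
  induction μ.parts using Multiset.induction_on with
  | empty => simp
  | cons a s ih =>
    rw [Multiset.map_cons, Multiset.prod_cons, ih, Multiset.map_cons, ← Multiset.singleton_add,
      Multiset.toFinsupp_add, Multiset.toFinsupp_singleton, MvPolynomial.X,
      MvPolynomial.monomial_mul, one_mul]

theorem parts_eq {n : ℕ} (μ : n.Partition) :
    (μ.parts.map Nat.toPNat').map (fun i : ℕ+ => (i : ℕ)) = μ.parts := by
  rw [Multiset.map_map]
  conv_rhs => rw [← Multiset.map_id μ.parts]
  refine Multiset.map_congr rfl fun k hk => ?_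
  have := μ.parts_pos hk
  simp [this]

/-- `⟨p_μ, p_ν⟩ = δ_{μν} α ^ l(μ) z_μ`. -/
theorem scalar_powerSum (μ ν : Ptn) :
    scalar (powerSum μ.2) (powerSum ν.2) =
      if μ = ν then α ^ len μ.2 * (z μ.2 : F) else 0 := by
  classical
  rw [powerSum_eq_monomial, powerSum_eq_monomial, scalar,
    MvPolynomial.support_monomial, if_neg one_ne_zero, Finset.sum_singleton,
    MvPolynomial.coeff_monomial, if_pos rfl, MvPolynomial.coeff_monomial, one_mul]
  by_cases h : μ = ν
  · subst h
    rw [if_pos rfl, if_pos rfl, one_mul]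
    obtain ⟨n, μ⟩ := μ
    have hp := parts_eq μ
    simp only
    generalize μ.parts.map Nat.toPNat' = s at hp ⊢
    congr 1
    · congr 1
      rw [len, ← hp, Multiset.card_map]
      exact Multiset.toFinsupp_sum_eq s
    · rw [z, ← hp, Finsupp.prod, Multiset.toFinsupp_support, Multiset.toFinset_map,
        Finset.prod_image (f := fun i => i ^ Multiset.count i (s.map fun i : ℕ+ => (i : ℕ)) *
          (Multiset.count i (s.map fun i : ℕ+ => (i : ℕ))).factorial) (fun a _ b _ hab => PNat.coe_injective hab)]
      push_cast
      refine Finset.prod_congr rfl fun i _ => ?_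
      rw [Multiset.count_map_eq_count' _ _ PNat.coe_injective, Multiset.toFinsupp_apply]
  · rw [if_neg h, if_neg, zero_mul]
    intro hc
    apply h
    have h1 := congrArg (Multiset.map (fun i : ℕ+ => (i : ℕ))) (Multiset.toFinsupp.injective hc)
    rw [parts_eq, parts_eq] at h1
    obtain ⟨n, μ⟩ := μ
    obtain ⟨m, ν⟩ := ν
    simp only at h1
    obtain rfl : n = m := by rw [← μ.parts_sum, ← ν.parts_sum, h1]
    rw [Nat.Partition.ext h1.symm]

end Jack

/-! Pairing with `q_μ` reads off the coefficient of `x^μ` (`form_qMono`), so the `q_μ` and the `m_μ`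
are dual bases in each degree (`dualFamilies`). Hence an orthogonal family that is unitriangular
downwards in the `m_μ` is, up to rescaling, an orthogonal family `Q` that is unitriangular upwards
in the `q_μ`. Dominance is only a partial order, so Gram-Schmidt alone does not produce `Q`. It
comes instead from a self-adjoint operator that is triangular in the `q_μ` with pairwise distinct
eigenvalues: its unitriangular eigenvectors are orthogonal. `D` itself does not suffice, since for
example `(4,1,1)` and `(3,3)` have the same `e`.

Further operators come from the Nazarov-Sklyanin operator `lax` on polynomials in `v` over the
symmetric functions: `ham j = gradAdj ∘ lax ^ j ∘ grad`, with `ham 1 = D` (`D_eq_ham`). They are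
self-adjoint because `grad` and `gradAdj` are adjoint and `lax` is symmetric on multiples of `v`
(`form_ham`). They are triangular for two reasons: `E_n = grad q_n` is an eigenvector of `lax` with
eigenvalue `αn - 1` (`lax_rowV`), and `E_c E_m` equals `-E_min q_max` up to terms of strictly more
dominant index (`rowV_mul_rowV_mem_lowV`). The diagonal entry of `ham j` at `q_ν` is `α^(j+1) ∑
ν_i^(j+1)` plus lower powers of `α` (`ham_q_sub_mem`), and for `j = 1` it is exactly `e_ν`
(`ham_one_q_sub_mem`). A suitable combination of the `ham j` has leading coefficient `∑ ν_i
(n+1)^(ν_i)`, which determines `ν` (`exists_separating_operator`).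

Once `Q` exists, every triangular self-adjoint operator is diagonal on it (`map_eq_smul`); this
gives the eigenvalue of `D`. Conversely a unitriangular eigenvector of `D` must be `Q_λ`, because
`e_μ ≠ e_λ` for `μ > λ` (`e_ne`): going up in dominance strictly lowers `∑ i λ_i`. -/

namespace Jack

/-! ### The scalar product as a bilinear form, and the one-row functions `q_n`. -/

open MvPolynomial

/-- The squared norm of the monomial `∏ p_i ^ d_i`. -/
noncomputable def weightNorm (d : ℕ+ →₀ ℕ) : F :=
  α ^ (d.sum fun _ m => m) * d.prod fun i m => ((i : ℕ) : F) ^ m * (m.factorial : F)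

theorem α_ne_zero : α ≠ 0 := RatFunc.X_ne_zero

theorem weightNorm_ne_zero (d : ℕ+ →₀ ℕ) : weightNorm d ≠ 0 := by
  refine mul_ne_zero (pow_ne_zero _ α_ne_zero) (Finset.prod_ne_zero_iff.2 fun i _ => ?_)
  have h1 : ((i : ℕ) : F) ≠ 0 := Nat.cast_ne_zero.2 i.ne_zero
  have h2 : ((d i).factorial : F) ≠ 0 := Nat.cast_ne_zero.2 (Nat.factorial_ne_zero _)
  exact mul_ne_zero (pow_ne_zero _ h1) h2

theorem weightNorm_add_single (d : ℕ+ →₀ ℕ) (l : ℕ+) :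
    weightNorm (d + Finsupp.single l 1) = α * (l : ℕ) * (d l + 1) * weightNorm d := by
  classical
  have he : (d + Finsupp.single l 1).erase l = d.erase l := by
    ext i
    by_cases h : i = l
    · simp [h]
    · simp [Finsupp.erase_ne h]
  have h1 := Finsupp.mul_prod_erase' (d + Finsupp.single l 1) l
    (fun i m => ((i : ℕ) : F) ^ m * (m.factorial : F)) (by simp)
  have h2 := Finsupp.mul_prod_erase' d l
    (fun i m => ((i : ℕ) : F) ^ m * (m.factorial : F)) (by simp)
  have h3 : ((d + Finsupp.single l 1).sum fun _ m => m) = (d.sum fun _ m => m) + 1 := by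
    rw [Finsupp.sum_add_index' (by simp) (by simp), Finsupp.sum_single_index rfl]
  rw [weightNorm, weightNorm, h3, ← h1, ← h2, he]
  simp only [Finsupp.add_apply, Finsupp.single_eq_same, Nat.factorial_succ]
  push_cast
  ring

theorem scalar_eq_sum (f g : Sym) (s : Finset (ℕ+ →₀ ℕ)) (h : f.support ⊆ s) :
    scalar f g = ∑ d ∈ s, f.coeff d * g.coeff d * weightNorm d := by
  refine Finset.sum_subset h fun d _ hd => ?_
  rw [notMem_support_iff.1 hd]
  simp

/-- The Jack scalar product as a bilinear form. -/
noncomputable def form : Sym →ₗ[F] Sym →ₗ[F] F :=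
  LinearMap.mk₂ F scalar
    (fun f f' g => by
      classical
      rw [scalar_eq_sum f g (f.support ∪ f'.support) Finset.subset_union_left,
        scalar_eq_sum f' g (f.support ∪ f'.support) Finset.subset_union_right,
        scalar_eq_sum _ g (f.support ∪ f'.support) support_add, ← Finset.sum_add_distrib]
      exact Finset.sum_congr rfl fun d _ => by rw [coeff_add]; ring)
    (fun c f g => by
      rw [scalar_eq_sum (c • f) g f.support support_smul, scalar, smul_eq_mul, Finset.mul_sum]
      exact Finset.sum_congr rfl fun d _ => by rw [coeff_smul, smul_eq_mul, weightNorm]; ring)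
    (fun f g g' => by
      rw [scalar, scalar, scalar, ← Finset.sum_add_distrib]
      exact Finset.sum_congr rfl fun d _ => by rw [coeff_add]; ring)
    (fun c f g => by
      rw [scalar, scalar, smul_eq_mul, Finset.mul_sum]
      exact Finset.sum_congr rfl fun d _ => by rw [coeff_smul, smul_eq_mul]; ring)

theorem form_apply (f g : Sym) : form f g = scalar f g := rfl

theorem form_comm (f g : Sym) : form f g = form g f := by
  classical
  rw [form_apply, form_apply, scalar_eq_sum f g (f.support ∪ g.support) Finset.subset_union_left,
    scalar_eq_sum g f (f.support ∪ g.support) Finset.subset_union_right]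
  exact Finset.sum_congr rfl fun d _ => by ring

theorem form_monomial_left (d : ℕ+ →₀ ℕ) (g : Sym) :
    form (monomial d 1) g = g.coeff d * weightNorm d := by
  classical
  rw [form_apply, scalar_eq_sum _ g {d} support_monomial_subset]
  simp

theorem form_monomial_right (d : ℕ+ →₀ ℕ) (f : Sym) :
    form f (monomial d 1) = f.coeff d * weightNorm d := by
  rw [form_comm, form_monomial_left]

theorem ext_form {f g : Sym} (h : ∀ d, form f (monomial d 1) = form g (monomial d 1)) :
    f = g := by
  ext d
  have := h d
  rw [form_monomial_right, form_monomial_right] at this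
  exact mul_right_cancel₀ (weightNorm_ne_zero d) this

theorem eq_zero_of_form {f : Sym} (h : ∀ g, form g f = 0) : f = 0 :=
  ext_form fun d => by rw [form_comm, h, map_zero, LinearMap.zero_apply]

/-- Multiplication by `p_l` is adjoint to `α l ∂/∂p_l`. -/
theorem form_X_mul (l : ℕ+) (f g : Sym) :
    form (X l * f) g = form f ((α * (l : ℕ)) • pderiv l g) := by
  induction f using MvPolynomial.induction_on' with
  | add f f' hf hf' => rw [mul_add, map_add, LinearMap.add_apply, hf, hf', map_add,
      LinearMap.add_apply]
  | monomial d a =>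
    have hX : (X l * monomial d a : Sym) = a • monomial (d + Finsupp.single l 1) 1 := by
      rw [X, monomial_mul, smul_monomial, add_comm]; simp
    have hm : (monomial d a : Sym) = a • monomial d 1 := by rw [smul_monomial]; simp
    rw [hX, hm, map_smul, LinearMap.smul_apply, map_smul (form (a • monomial d 1)), map_smul,
      LinearMap.smul_apply, form_monomial_left, form_monomial_left, weightNorm_add_single]
    have : coeff d (pderiv l g) = (d l + 1) * coeff (d + Finsupp.single l 1) g := by
      rw [coeff_pderiv]; ring
    simp only [this, smul_eq_mul]
    ring

/-- The total degree in the variables `x_i` of a monomial in the power sums. -/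
noncomputable def wt (d : ℕ+ →₀ ℕ) : ℕ := d.sum fun i m => m * (i : ℕ)

/-- The partition that a monomial in the power sums belongs to. -/
noncomputable def toPtn (d : ℕ+ →₀ ℕ) : (wt d).Partition where
  parts := (Finsupp.toMultiset d).map fun i : ℕ+ => (i : ℕ)
  parts_pos := by
    intro i hi
    obtain ⟨j, _, rfl⟩ := Multiset.mem_map.1 hi
    exact j.pos
  parts_sum := by
    induction d using Finsupp.induction_linear with
    | zero => simp [wt]
    | add f g hf hg => rw [map_add, Multiset.map_add, Multiset.sum_add, hf, hg, wt, wt, wt,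
        Finsupp.sum_add_index' (by simp) (fun _ _ _ => add_mul _ _ _)]
    | single i m => simp [wt, Finsupp.toMultiset_single, Multiset.map_nsmul, Multiset.sum_nsmul]

theorem powerSum_toPtn (d : ℕ+ →₀ ℕ) : powerSum (toPtn d) = monomial d 1 := by
  rw [powerSum_eq_monomial]
  congr 1
  have : ((toPtn d).parts.map Nat.toPNat') = Finsupp.toMultiset d := by
    rw [toPtn, Multiset.map_map]
    conv_rhs => rw [← Multiset.map_id (Finsupp.toMultiset d)]
    exact Multiset.map_congr rfl fun i _ => by simp
  rw [this]
  simp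

/-- The coefficients of `q_n` are the inverse norms of the `p_μ`, so `q_n` represents the functional
taking every `p_μ` of degree `n` to 1. -/
theorem form_qRow_powerSum (n : ℕ) (ν : Ptn) :
    form (qRow n) (powerSum ν.2) = if ν.1 = n then 1 else 0 := by
  classical
  rw [qRow, map_sum, LinearMap.sum_apply]
  simp only [map_smul, LinearMap.smul_apply, form_apply, smul_eq_mul]
  obtain ⟨m, ν⟩ := ν
  by_cases h : m = n
  · subst h
    rw [Finset.sum_eq_single ν]
    · rw [scalar_powerSum ⟨m, ν⟩ ⟨m, ν⟩, if_pos rfl, if_pos rfl]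
      have h1 : α ^ len ν ≠ 0 := pow_ne_zero _ α_ne_zero
      have h2 : (z ν : F) ≠ 0 := by
        refine Nat.cast_ne_zero.2 (Finset.prod_ne_zero_iff.2 fun i hi => ?_)
        have := ν.parts_pos (Multiset.mem_toFinset.1 hi)
        positivity
      field_simp
    · intro μ _ hμ
      rw [scalar_powerSum ⟨m, μ⟩ ⟨m, ν⟩, if_neg, mul_zero]
      simpa using hμ
    · simp
  · rw [if_neg h]
    refine Finset.sum_eq_zero fun μ _ => ?_
    rw [scalar_powerSum ⟨n, μ⟩ ⟨m, ν⟩, if_neg, mul_zero]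
    intro hc
    exact h (congrArg Sigma.fst hc).symm

theorem form_qRow_monomial (n : ℕ) (d : ℕ+ →₀ ℕ) :
    form (qRow n) (monomial d 1) = if wt d = n then 1 else 0 := by
  rw [← powerSum_toPtn]
  exact form_qRow_powerSum n ⟨wt d, toPtn d⟩

theorem wt_add_single (d : ℕ+ →₀ ℕ) (l : ℕ+) : wt (d + Finsupp.single l 1) = wt d + l := by
  rw [wt, Finsupp.sum_add_index' (by simp) (fun _ _ _ => add_mul _ _ _),
    Finsupp.sum_single_index (by simp), one_mul, wt]

theorem qRow_zero : qRow 0 = 1 := by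
  refine ext_form fun d => ?_
  rw [form_qRow_monomial, form_monomial_right, coeff_one]
  by_cases h : d = 0
  · subst h; simp [wt, weightNorm]
  · rw [if_neg (Ne.symm h), zero_mul, if_neg]
    intro hw
    apply h
    rw [wt, Finsupp.sum, Finset.sum_eq_zero_iff] at hw
    ext i
    by_contra hi
    have := hw i (Finsupp.mem_support_iff.2 hi)
    simp_all

/-- By adjointness, pairing the left side with a monomial of weight `w` pairs `q_n` with a monomial
of weight `w + l`, which only tests whether `w + l = n`. -/
theorem pderiv_qRow (l : ℕ+) (n : ℕ) :
    (α * (l : ℕ)) • pderiv l (qRow n) = if (l : ℕ) ≤ n then qRow (n - l) else 0 := by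
  refine ext_form fun d => ?_
  rw [form_comm, ← form_X_mul]
  have hX : (X l * monomial d 1 : Sym) = monomial (d + Finsupp.single l 1) 1 := by
    rw [X, monomial_mul, add_comm]; simp
  rw [hX, form_comm, form_qRow_monomial, wt_add_single]
  split_ifs with h1 h2 h2
  · rw [form_qRow_monomial, if_pos (by omega)]
  · omega
  · rw [form_qRow_monomial, if_neg (by omega)]
  · simp

end Jack

/-! ### The Lax operator and its eigenvectors `E_n`. -/

namespace Jack

open MvPolynomial

/-- Polynomials in an auxiliary variable `v` over the ring of symmetric functions. -/
abbrev SymV : Type := Polynomial Sym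

/-- The power sum `p_k`, for `k ≥ 1`. -/
noncomputable def pw (k : ℕ) : Sym := X k.toPNat'

/-- The gradient `f ↦ ∑ l, v ^ l * (α l ∂f/∂p_l)`. -/
noncomputable def grad : Derivation F Sym SymV :=
  mkDerivation F fun l => Polynomial.monomial (l : ℕ) (C (α * (l : ℕ)))

/-- The `Sym`-linear map with `v ^ k ↦ p_k` for `k ≥ 1` and `1 ↦ 0`, adjoint to `grad`. -/
noncomputable def gradAdj : SymV →ₗ[Sym] Sym :=
  Polynomial.lsum fun k => LinearMap.toSpanSingleton Sym Sym (if k = 0 then 0 else pw k)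

/-- The Lax operator of Nazarov and Sklyanin. -/
noncomputable def lax : SymV →ₗ[F] SymV :=
  Polynomial.lsum fun k =>
    LinearMap.mulLeft F (Polynomial.X ^ k : SymV) ∘ₗ (grad : Sym →ₗ[F] SymV) +
    ((α - 1) * (k : F)) • (Polynomial.monomial k : Sym →ₗ[Sym] SymV).restrictScalars F +
    ∑ m ∈ Finset.Ico 1 k, (Polynomial.monomial m : Sym →ₗ[Sym] SymV).restrictScalars F ∘ₗ
      LinearMap.mulLeft F (pw (k - m))

theorem lsum_monomial {M : Type*} [AddCommMonoid M] [Module F M] (φ : ℕ → Sym →ₗ[F] M) (k : ℕ)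
    (f : Sym) : Polynomial.lsum φ (Polynomial.monomial k f) = φ k f :=
  Polynomial.sum_monomial_index _ _ (map_zero _)

theorem gradAdj_monomial (k : ℕ) (f : Sym) :
    gradAdj (Polynomial.monomial k f) = if k = 0 then 0 else pw k * f := by
  simp [gradAdj, Polynomial.lsum, Polynomial.sum_monomial_index, mul_comm]

theorem lax_monomial (k : ℕ) (f : Sym) :
    lax (Polynomial.monomial k f) = Polynomial.X ^ k * grad f +
      ((α - 1) * (k : F)) • Polynomial.monomial k f +
      ∑ m ∈ Finset.Ico 1 k, Polynomial.monomial m (pw (k - m) * f) := by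
  rw [lax, lsum_monomial]
  simp

theorem grad_X (l : ℕ+) : grad (X l) = Polynomial.monomial (l : ℕ) (C (α * (l : ℕ))) :=
  mkDerivation_X _ _ _

theorem coeff_grad_pnat (l : ℕ+) (f : Sym) :
    (grad f).coeff l = (α * (l : ℕ)) • pderiv l f := by
  have : (Polynomial.lcoeff Sym (l : ℕ)).compDer grad =
      (α * (l : ℕ)) • (pderiv l : Derivation F Sym Sym) := by
    refine derivation_ext fun k => ?_
    change (grad (X k)).coeff (l : ℕ) = (α * (l : ℕ)) • pderiv l (X k)
    simp only [grad_X, Polynomial.coeff_monomial, pderiv_X, Pi.single_apply, PNat.coe_inj]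
    by_cases h : k = l
    · subst h; simp [MvPolynomial.smul_eq_C_mul]
    · simp [h]
  exact congrArg (fun δ : Derivation F Sym Sym => δ f) this

theorem coeff_grad_zero (f : Sym) : (grad f).coeff 0 = 0 := by
  have : (Polynomial.lcoeff Sym 0).compDer grad = (0 : Derivation F Sym Sym) := by
    refine derivation_ext fun k => ?_
    change (grad (X k)).coeff 0 = 0
    simp [grad_X, Polynomial.coeff_monomial]
  exact congrArg (fun δ : Derivation F Sym Sym => δ f) this

/-- All of `lax` is linear over symmetric functions except the gradient, which obeys the Leibniz
rule. -/
theorem lax_mul_C (g : SymV) (f : Sym) :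
    lax (g * Polynomial.C f) = lax g * Polynomial.C f + g * grad f := by
  induction g using Polynomial.induction_on' with
  | add g g' hg hg' => rw [add_mul, map_add, hg, hg', map_add]; ring
  | monomial k a =>
    rw [Polynomial.monomial_mul_C, lax_monomial, lax_monomial, Derivation.leibniz, add_mul,
      add_mul, Finset.sum_mul, smul_mul_assoc, Polynomial.monomial_mul_C]
    simp only [← Polynomial.C_mul_X_pow_eq_monomial, Polynomial.smul_eq_C_mul, map_mul]
    have : ∀ m, (Polynomial.C (pw (k - m)) * (Polynomial.C a * Polynomial.C f) *
        Polynomial.X ^ m : SymV) =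
        Polynomial.C (pw (k - m)) * Polynomial.C a * Polynomial.X ^ m * Polynomial.C f :=
      fun m => by ring
    simp only [this]
    ring

/-- Shifting `v^k` to `v^(k+1)` shifts each term of `lax`, adds one `α - 1` on the diagonal, and
creates the single new term `p_k v`, which is what `gradAdj` records. This matches the recursion
defining `rowV`. -/
theorem lax_X_mul (g : SymV) :
    lax (Polynomial.X * g) =
      Polynomial.X * (lax g + (α - 1) • g + Polynomial.C (gradAdj g)) := by
  induction g using Polynomial.induction_on' with
  | add g g' hg hg' => rw [mul_add, map_add, hg, hg', map_add, map_add, map_add, smul_add]; ring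
  | monomial k a =>
    rw [Polynomial.X_mul_monomial, lax_monomial, lax_monomial, gradAdj_monomial]
    have h : ∑ m ∈ Finset.Ico 1 (k + 1), Polynomial.monomial m (pw (k + 1 - m) * a) =
        Polynomial.X * (∑ m ∈ Finset.Ico 1 k, Polynomial.monomial m (pw (k - m) * a) +
          Polynomial.C (if k = 0 then 0 else pw k * a)) := by
      rw [Finset.sum_Ico_eq_sum_range, mul_add, Finset.mul_sum, Finset.sum_Ico_eq_sum_range]
      cases k with
      | zero => simp
      | succ k =>
        rw [if_neg (by omega), Nat.add_sub_cancel, Finset.sum_range_succ', Nat.add_sub_cancel,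
          Polynomial.X_mul_C, Polynomial.C_mul_X_eq_monomial]
        congr 1
        refine Finset.sum_congr rfl fun i _ => ?_
        rw [Polynomial.X_mul_monomial, show k + 1 + 1 - (1 + (i + 1)) = k + 1 - (1 + i) by omega]
        rfl
    rw [h, ← Polynomial.X_mul_monomial, pow_succ]
    push_cast
    simp only [mul_add, add_smul, mul_one, ← mul_smul_comm]
    ring

/-- The polynomials `E_n = ∑_{l=1}^n v ^ l q_{n-l}`. -/
noncomputable def rowV : ℕ → SymV
  | 0 => 0
  | n + 1 => Polynomial.X * (rowV n + Polynomial.C (qRow n))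

theorem rowV_zero : rowV 0 = 0 := rfl

theorem rowV_succ (n : ℕ) :
    rowV (n + 1) = Polynomial.X * (rowV n + Polynomial.C (qRow n)) := rfl

theorem coeff_rowV (n k : ℕ) :
    (rowV n).coeff k = if 1 ≤ k ∧ k ≤ n then qRow (n - k) else 0 := by
  induction n generalizing k with
  | zero => rw [rowV_zero, Polynomial.coeff_zero, if_neg (by omega)]
  | succ n ih =>
    rw [rowV_succ]
    cases k with
    | zero => simp
    | succ k =>
      rw [Polynomial.coeff_X_mul, Polynomial.coeff_add, ih, Polynomial.coeff_C]
      by_cases h0 : k = 0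
      · subst h0; simp
      · rw [if_neg h0, add_zero, Nat.add_sub_add_right]
        exact if_congr (by omega) rfl rfl

theorem grad_qRow (n : ℕ) : grad (qRow n) = rowV n := by
  ext1 k
  rw [coeff_rowV]
  rcases Nat.eq_zero_or_pos k with rfl | h
  · rw [coeff_grad_zero, if_neg (by omega)]
  · have := coeff_grad_pnat ⟨k, h⟩ (qRow n)
    refine (this.trans (pderiv_qRow ⟨k, h⟩ n)).trans (if_congr ?_ rfl rfl)
    exact ⟨fun hk => ⟨h, hk⟩, fun hk => hk.2⟩

theorem gradAdj_mul_C (g : SymV) (f : Sym) :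
    gradAdj (g * Polynomial.C f) = gradAdj g * f := by
  rw [mul_comm, ← Polynomial.smul_eq_C_mul, map_smul, smul_eq_mul, mul_comm]

/-- `gradAdj ∘ grad` is `α` times the Euler operator `∑ l p_l ∂/∂p_l`. -/
theorem gradAdj_grad_multiset (s : Multiset ℕ) (hs : ∀ k ∈ s, 0 < k) :
    gradAdj (grad (s.map fun k => (X k.toPNat' : Sym)).prod) =
      (α * (s.sum : F)) • (s.map fun k => (X k.toPNat' : Sym)).prod := by
  induction s using Multiset.induction_on with
  | empty => simp
  | cons k s ih =>
    have hk := hs k (by simp)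
    rw [Multiset.map_cons, Multiset.prod_cons, Derivation.leibniz, map_add, map_smul, map_smul,
      ih fun j hj => hs j (Multiset.mem_cons_of_mem hj), grad_X, gradAdj_monomial, if_neg
      (PNat.ne_zero _), Multiset.sum_cons]
    have : (k.toPNat' : ℕ) = k := by simp [hk]
    rw [pw, this]
    simp only [smul_eq_mul, MvPolynomial.smul_eq_C_mul, Nat.cast_add, mul_add, map_add]
    ring

theorem gradAdj_rowV (n : ℕ) : gradAdj (rowV n) = (α * (n : F)) • qRow n := by
  rw [← grad_qRow, qRow, map_sum, map_sum, Finset.smul_sum]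
  refine Finset.sum_congr rfl fun μ _ => ?_
  have hs : ∀ (c : F) (g : SymV), gradAdj (c • g) = c • gradAdj g := fun c g =>
    (gradAdj.restrictScalars F).map_smul c g
  have h := gradAdj_grad_multiset μ.parts fun k hk => μ.parts_pos hk
  rw [μ.parts_sum] at h
  rw [Derivation.map_smul, hs, powerSum, h, smul_comm]

/-- In `E_{n+1} = v (E_n + q_n)` the shift rule gives `E_n` the factor `(αn - 1) + 1 + (α - 1)`, the
1 coming from `grad q_n = E_n`, and gives `q_n` the factor `(α - 1) + αn`. The two agree. -/
theorem lax_rowV (n : ℕ) : lax (rowV n) = (α * (n : F) - 1) • rowV n := by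
  induction n with
  | zero => simp [rowV_zero]
  | succ n ih =>
    have h0 : lax (Polynomial.C (qRow n)) = rowV n := by
      have := lax_monomial 0 (qRow n)
      simpa [grad_qRow] using this
    have h1 : gradAdj (Polynomial.C (qRow n)) = 0 := by
      have := gradAdj_monomial 0 (qRow n)
      simpa using this
    rw [rowV_succ, lax_X_mul, map_add, map_add, ih, h0, h1, gradAdj_rowV, add_zero,
      ← mul_smul_comm]
    congr 1
    have h2 : Polynomial.C ((α * (n : F)) • qRow n) =
        (α * (n : F)) • (Polynomial.C (qRow n) : SymV) := by
      rw [Polynomial.smul_C]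
    rw [h2, Nat.cast_succ]
    simp only [smul_add, sub_smul, add_smul, mul_add, one_smul, mul_one]
    abel

/-- Moves one unit from the second index to the first; iterated, it ends at `E_0 = 0`. -/
theorem rowV_mul_rowV (c m : ℕ) :
    rowV c * rowV (m + 1) = rowV (c + 1) * rowV m + rowV (c + 1) * Polynomial.C (qRow m) -
      rowV (m + 1) * Polynomial.C (qRow c) := by
  rw [rowV_succ, rowV_succ]; ring

/-! ### Self-adjointness of the operators `ham j`. -/

/-- The scalar product on `SymV` for which the powers of `v` are orthonormal over `Sym`. -/
noncomputable def formV : SymV →ₗ[F] SymV →ₗ[F] F :=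
  Polynomial.lsum fun k => (form.compl₂ ((Polynomial.lcoeff Sym k).restrictScalars F))

theorem formV_monomial_left (k : ℕ) (f : Sym) (g : SymV) :
    formV (Polynomial.monomial k f) g = form f (g.coeff k) := by
  rw [formV, lsum_monomial]
  rfl

theorem formV_comm (f g : SymV) : formV f g = formV g f := by
  induction f using Polynomial.induction_on' with
  | add f f' h h' => rw [map_add, LinearMap.add_apply, h, h', map_add]
  | monomial k a =>
    induction g using Polynomial.induction_on' with
    | add f f' h h' => rw [map_add, h, h', map_add, LinearMap.add_apply]
    | monomial m b =>
      rw [formV_monomial_left, formV_monomial_left, Polynomial.coeff_monomial,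
        Polynomial.coeff_monomial]
      by_cases h : k = m
      · subst h; rw [if_pos rfl, if_pos rfl, form_comm]
      · rw [if_neg h, if_neg (Ne.symm h), map_zero, map_zero]

theorem form_pw_mul {k : ℕ} (hk : k ≠ 0) (f g : Sym) :
    form (pw k * f) g = form f ((grad g).coeff k) := by
  have h := coeff_grad_pnat k.toPNat' g
  rw [pw, form_X_mul, ← h]
  congr 3
  simp [Nat.pos_of_ne_zero hk]

theorem formV_grad (f : Sym) (g : SymV) : formV g (grad f) = form (gradAdj g) f := by
  induction g using Polynomial.induction_on' with
  | add g g' h h' => simp only [map_add, LinearMap.add_apply, h, h']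
  | monomial k a =>
    rw [formV_monomial_left, gradAdj_monomial]
    split_ifs with h
    · subst h; simp [coeff_grad_zero]
    · rw [form_pw_mul h]

theorem coeff_lax_monomial {k m : ℕ} (hm : m ≠ 0) (a : Sym) :
    (lax (Polynomial.monomial k a)).coeff m =
      if m < k then pw (k - m) * a else if m = k then ((α - 1) * (k : F)) • a
      else (grad a).coeff (m - k) := by
  rw [lax_monomial, Polynomial.coeff_add, Polynomial.coeff_add, Polynomial.finsetSum_coeff,
    Polynomial.coeff_smul, Polynomial.coeff_monomial, mul_comm, Polynomial.coeff_mul_X_pow']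
  simp only [Polynomial.coeff_monomial, Finset.sum_ite_eq', Finset.mem_Ico]
  rcases lt_trichotomy m k with h | h | h
  · rw [if_neg (by omega), if_neg (by omega), if_pos (by omega), if_pos h]; simp
  · subst h; simp [coeff_grad_zero]
  · rw [if_pos (by omega), if_neg (by omega), if_neg (by omega), if_neg (by omega),
      if_neg (by omega)]; simp

/-- For `m < k` the entry `p_{k-m}` from `v^k` to `v^m` is adjoint to the entry `α (k-m) ∂/∂p_{k-m}`
from `v^m` to `v^k`. Multiples of `v` are needed because the sum in `lax` stops at `v^1`, so nothing
matches the gradient leaving `v^0`. -/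
theorem formV_lax_X_mul (f g : SymV) :
    formV (lax (Polynomial.X * f)) (Polynomial.X * g) =
      formV (Polynomial.X * f) (lax (Polynomial.X * g)) := by
  induction f using Polynomial.induction_on' with
  | add f f' h h' => simp only [mul_add, map_add, LinearMap.add_apply, h, h']
  | monomial k a =>
    induction g using Polynomial.induction_on' with
    | add f f' h h' => simp only [mul_add, map_add, h, h']
    | monomial m b =>
      rw [Polynomial.X_mul_monomial, Polynomial.X_mul_monomial, formV_comm, formV_monomial_left,
        formV_monomial_left, coeff_lax_monomial (by omega), coeff_lax_monomial (by omega)]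
      rcases lt_trichotomy m k with h | h | h
      · rw [if_pos (by omega), if_neg (by omega), if_neg (by omega), form_comm,
          form_pw_mul (by omega)]
      · subst h; simp [form_comm a b]
      · rw [if_neg (by omega), if_neg (by omega), if_pos (by omega), ← form_pw_mul (by omega),
          form_comm]

theorem X_dvd_grad (f : Sym) : Polynomial.X ∣ grad f :=
  Polynomial.X_dvd_iff.2 (coeff_grad_zero f)

theorem X_dvd_lax {f : SymV} (h : Polynomial.X ∣ f) : Polynomial.X ∣ lax f := by
  obtain ⟨g, rfl⟩ := h
  exact ⟨_, lax_X_mul g⟩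

theorem X_dvd_lax_pow {f : SymV} (h : Polynomial.X ∣ f) (j : ℕ) :
    Polynomial.X ∣ (lax ^ j) f := by
  induction j with
  | zero => exact h
  | succ j ih => rw [pow_succ', Module.End.mul_apply]; exact X_dvd_lax ih

theorem formV_lax_pow {f g : SymV} (hf : Polynomial.X ∣ f) (hg : Polynomial.X ∣ g) (j : ℕ) :
    formV ((lax ^ j) f) g = formV f ((lax ^ j) g) := by
  induction j generalizing g with
  | zero => rfl
  | succ j ih =>
    obtain ⟨f', hf'⟩ := X_dvd_lax_pow hf j
    obtain ⟨g', rfl⟩ := hg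
    have h1 : (lax ^ (j + 1)) f = lax ((lax ^ j) f) := by
      rw [pow_succ', Module.End.mul_apply]
    have h2 : (lax ^ (j + 1)) (Polynomial.X * g') = (lax ^ j) (lax (Polynomial.X * g')) := by
      rw [pow_succ, Module.End.mul_apply]
    rw [h1, h2, ← ih (X_dvd_lax (dvd_mul_right _ _)), hf', formV_lax_X_mul]

/-- The operators `gradAdj ∘ lax ^ j ∘ grad` on symmetric functions. -/
noncomputable def ham (j : ℕ) : Sym →ₗ[F] Sym :=
  gradAdj.restrictScalars F ∘ₗ (lax ^ j) ∘ₗ (grad : Sym →ₗ[F] SymV)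

theorem ham_apply (j : ℕ) (f : Sym) : ham j f = gradAdj ((lax ^ j) (grad f)) := rfl

theorem form_ham (j : ℕ) (f g : Sym) : form (ham j f) g = form f (ham j g) := by
  have h1 := formV_grad g ((lax ^ j) (grad f))
  have h2 := formV_lax_pow (X_dvd_grad f) (X_dvd_grad g) j
  have h3 := formV_grad f ((lax ^ j) (grad g))
  rw [ham_apply, ham_apply, ← h1, h2, formV_comm, h3]
  exact form_comm _ _

end Jack

namespace Jack

/-! ### Dominance -/

/-- The sum of the excesses of the elements of `s` over the threshold `t`. -/
def excess (t : ℕ) (s : Multiset ℕ) : ℕ := (s.map fun i => i - t).sum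

theorem excess_cons (t c : ℕ) (s : Multiset ℕ) : excess t (c ::ₘ s) = (c - t) + excess t s := by
  simp [excess]

theorem sum_getD_le (l : List ℕ) (t k : ℕ) :
    ∑ i ∈ Finset.range k, l.getD i 0 ≤ k * t + (l.map fun i => i - t).sum := by
  induction l generalizing k with
  | nil => simp
  | cons a l ih =>
    cases k with
    | zero => simp
    | succ k =>
      rw [Finset.sum_range_succ', List.map_cons, List.sum_cons]
      have := ih k
      simp only [List.getD_cons_succ, List.getD_cons_zero]
      rw [add_mul]
      omega

theorem le_sum_getD (l : List ℕ) (hl : l.Pairwise (· ≥ ·)) (k : ℕ) :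
    k * l.getD k 0 + (l.map fun i => i - l.getD k 0).sum ≤
      ∑ i ∈ Finset.range k, l.getD i 0 := by
  induction l generalizing k with
  | nil => simp
  | cons a l ih =>
    obtain ⟨ha, hl⟩ := List.pairwise_cons.1 hl
    cases k with
    | zero =>
      have : ((a :: l).map fun i => i - a).sum = 0 := by
        rw [List.sum_eq_zero_iff]
        intro x hx
        obtain ⟨i, hi, rfl⟩ := List.mem_map.1 hx
        rcases List.mem_cons.1 hi with rfl | hi
        · omega
        · have := ha i hi; omega
      simpa using this
    | succ k =>
      rw [Finset.sum_range_succ', List.map_cons, List.sum_cons]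
      have := ih hl k
      simp only [List.getD_cons_succ, List.getD_cons_zero]
      have hk : l.getD k 0 ≤ a := by
        rw [List.getD_eq_getElem?_getD]
        by_cases h : k < l.length
        · rw [List.getElem?_eq_getElem h]; exact ha _ (List.getElem_mem h)
        · rw [List.getElem?_eq_none (by omega)]; simp
      rw [add_mul]
      omega

theorem excess_parts {n : ℕ} (μ : n.Partition) (t : ℕ) :
    excess t μ.parts = ((μ.parts.sort (· ≥ ·)).map fun i => i - t).sum := by
  conv_lhs => rw [← μ.parts.sort_eq (· ≥ ·)]
  rw [excess, Multiset.map_coe, Multiset.sum_coe]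

/-- The sum of the `k` largest parts is the minimum over `t` of `k t` plus the excess over `t`,
attained at a part. Excesses need no sorting and are additive, which suits the multisets arising
below. -/
theorem dominates_of_excess {n : ℕ} {μ ν : n.Partition}
    (h : ∀ t, excess t ν.parts ≤ excess t μ.parts) : Dominates μ ν := by
  intro k
  have h1 := sum_getD_le (ν.parts.sort (· ≥ ·)) (part μ k) k
  have h2 := le_sum_getD (μ.parts.sort (· ≥ ·)) (μ.parts.pairwise_sort _) k
  have h3 := h (part μ k)
  rw [excess_parts, excess_parts] at h3
  unfold part at *
  omega

theorem eq_of_getD_eq (l l' : List ℕ) (hl : ∀ i ∈ l, 0 < i) (hl' : ∀ i ∈ l', 0 < i)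
    (h : ∀ i, l.getD i 0 = l'.getD i 0) : l = l' := by
  induction l generalizing l' with
  | nil =>
    cases l' with
    | nil => rfl
    | cons b l' => have := h 0; have := hl' b (by simp); simp_all
  | cons a l ih =>
    cases l' with
    | nil => have := h 0; have := hl a (by simp); simp_all
    | cons b l' =>
      have h0 := h 0
      rw [ih l' (fun i hi => hl i (by simp [hi])) (fun i hi => hl' i (by simp [hi]))
        fun i => h (i + 1)]
      simpa using h0

theorem eq_of_part_eq {n : ℕ} {μ ν : n.Partition} (h : ∀ i, part μ i = part ν i) : μ = ν := by
  have := eq_of_getD_eq (μ.parts.sort (· ≥ ·)) (ν.parts.sort (· ≥ ·))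
    (fun i hi => μ.parts_pos (by simpa using hi)) (fun i hi => ν.parts_pos (by simpa using hi)) h
  ext1
  rw [← μ.parts.sort_eq (· ≥ ·), ← ν.parts.sort_eq (· ≥ ·), this]

theorem eq_of_sum_part_eq {n : ℕ} {μ ν : n.Partition}
    (h : ∀ k, ∑ i ∈ Finset.range k, part μ i = ∑ i ∈ Finset.range k, part ν i) : μ = ν := by
  refine eq_of_part_eq fun i => ?_
  have h1 := h (i + 1)
  rw [Finset.sum_range_succ, Finset.sum_range_succ, h i] at h1
  omega

/-- The dominance order on the partitions of `n`. -/
instance dominanceOrder (n : ℕ) : PartialOrder n.Partition where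
  le ν μ := Dominates μ ν
  le_refl _ _ := le_rfl
  le_trans _ _ _ h h' k := (h k).trans (h' k)
  le_antisymm _ _ h h' := eq_of_sum_part_eq fun k => le_antisymm (h k) (h' k)

/-! ### The eigenvalues -/

theorem sum_range_getD {M : Type*} [AddCommMonoid M] (l : List ℕ) (f : ℕ → M) :
    ∑ i ∈ Finset.range l.length, f (l.getD i 0) = (l.map f).sum := by
  induction l with
  | nil => simp
  | cons a l ih =>
    rw [List.length_cons, Finset.sum_range_succ', List.map_cons, List.sum_cons, ← ih, add_comm]
    simp

theorem len_eq {n : ℕ} (μ : n.Partition) : len μ = (μ.parts.sort (· ≥ ·)).length := by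
  simp [len]

theorem sum_range_part {M : Type*} [AddCommMonoid M] {n : ℕ} (μ : n.Partition) (f : ℕ → M) :
    ∑ i ∈ Finset.range (len μ), f (part μ i) = (μ.parts.map f).sum := by
  conv_rhs => rw [← μ.parts.sort_eq (· ≥ ·), Multiset.map_coe, Multiset.sum_coe]
  rw [← sum_range_getD, len_eq]
  rfl

/-- For a decreasing list the minimum of two entries is the one of larger index, and `i`, counted
from 0, is the larger index of `2 i + 1` ordered pairs. -/
theorem sum_min_list (l : List ℕ) (hl : l.Pairwise (· ≥ ·)) :
    (l.map fun i => (l.map fun j => min i j).sum).sum =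
      ∑ i ∈ Finset.range l.length, (2 * i + 1) * l.getD i 0 := by
  induction l with
  | nil => simp
  | cons a l ih =>
    obtain ⟨ha, hl⟩ := List.pairwise_cons.1 hl
    have h1 : (l.map fun j => min a j) = l :=
      (List.map_congr_left fun j hj => min_eq_right (ha j hj)).trans (List.map_id _)
    have h2 : (l.map fun i => ((a :: l).map fun j => min i j).sum).sum =
        l.sum + (l.map fun i => (l.map fun j => min i j).sum).sum := by
      have : (l.map fun i => ((a :: l).map fun j => min i j).sum) =
          l.map fun i => i + (l.map fun j => min i j).sum :=
        List.map_congr_left fun i hi => by simp [min_eq_left (ha i hi)]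
      rw [this, List.sum_map_add, List.map_id']
    rw [List.map_cons, List.sum_cons, h2, List.map_cons, List.sum_cons, h1, ih hl,
      List.length_cons, Finset.sum_range_succ']
    have h3 := sum_range_getD l id
    rw [List.map_id] at h3
    simp only [List.getD_cons_succ, List.getD_cons_zero, id_eq, min_self, ← h3] at *
    have h4 : ∀ i, (2 * (i + 1) + 1) * l.getD i 0 =
        2 * l.getD i 0 + (2 * i + 1) * l.getD i 0 := fun i => by ring
    simp only [h4, Finset.sum_add_distrib, ← Finset.mul_sum]
    omega

theorem sum_min_parts {n : ℕ} (μ : n.Partition) :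
    (μ.parts.map fun i => (μ.parts.map fun j => min i j).sum).sum =
      ∑ i ∈ Finset.range (len μ), (2 * i + 1) * part μ i := by
  have := sum_min_list (μ.parts.sort (· ≥ ·)) (μ.parts.pairwise_sort _)
  rw [len_eq]
  unfold part
  rw [← this]
  have hs := μ.parts.sort_eq (· ≥ ·)
  generalize μ.parts.sort (· ≥ ·) = l at *
  simp only [← hs, Multiset.map_coe, Multiset.sum_coe]

/-- This is the shape in which the diagonal entry of `D` arises: the minima come from the terms
`E_min q_max`. -/
theorem e_eq {n : ℕ} (μ : n.Partition) :
    e μ = α ^ 2 * ((μ.parts.map fun i => i ^ 2).sum : ℕ) -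
      α * ((μ.parts.map fun i => (μ.parts.map fun j => min i j).sum).sum : ℕ) := by
  have h1 := sum_range_part μ fun i => i ^ 2
  have h2 := sum_range_part μ fun i => i
  rw [Multiset.map_id', μ.parts_sum] at h2
  rw [sum_min_parts, ← h1, e]
  have h3 : (n : F) = ∑ i ∈ Finset.range (len μ), (part μ i : F) := by
    rw [← Nat.cast_sum, h2]
  rw [h3]
  push_cast
  simp only [add_mul, one_mul, Finset.sum_add_distrib, mul_assoc, ← Finset.mul_sum]
  ring

/-- Abel summation; it turns an inequality of partial sums into one for `∑ (i + 1) μ_i`. -/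
theorem sum_succ_mul_add (x : ℕ → ℕ) (K : ℕ) :
    ∑ i ∈ Finset.range K, (i + 1) * x i + ∑ k ∈ Finset.range K, ∑ i ∈ Finset.range k, x i =
      K * ∑ i ∈ Finset.range K, x i := by
  induction K with
  | zero => simp
  | succ K ih =>
    rw [Finset.sum_range_succ, Finset.sum_range_succ _ K, Finset.sum_range_succ _ K]
    linarith

theorem part_eq_zero {n : ℕ} (μ : n.Partition) {i : ℕ} (h : len μ ≤ i) : part μ i = 0 := by
  rw [len_eq] at h
  rw [part, List.getD_eq_getElem?_getD, List.getElem?_eq_none h]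
  rfl

theorem len_le {n : ℕ} (μ : n.Partition) : len μ ≤ n := by
  have := Multiset.card_nsmul_le_sum (s := μ.parts) (a := 1) fun i hi => μ.parts_pos hi
  rw [μ.parts_sum] at this
  simpa [len] using this

theorem sum_range_part_of_le {n K : ℕ} (μ : n.Partition) (h : n ≤ K) (f : ℕ → ℕ → ℕ)
    (hf : ∀ i, f i 0 = 0) :
    ∑ i ∈ Finset.range K, f i (part μ i) = ∑ i ∈ Finset.range (len μ), f i (part μ i) := by
  refine (Finset.sum_subset (Finset.range_mono ((len_le μ).trans h)) fun i _ hi => ?_).symm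
  rw [part_eq_zero μ (by simpa using hi), hf]

theorem sum_succ_mul_part_lt {n : ℕ} {μ ν : n.Partition} (h : Dominates μ ν) (hne : μ ≠ ν) :
    ∑ i ∈ Finset.range (len μ), (i + 1) * part μ i <
      ∑ i ∈ Finset.range (len ν), (i + 1) * part ν i := by
  obtain ⟨k, hk⟩ : ∃ k, ∑ i ∈ Finset.range k, part ν i < ∑ i ∈ Finset.range k, part μ i := by
    by_contra! hc
    exact hne (eq_of_sum_part_eq fun k => le_antisymm (hc k) (h k))
  -- The range `n + k + 1` covers all parts of both partitions and includes the index `k` of the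
  -- strict inequality.
  have hK : n ≤ n + k + 1 := by omega
  have hm := sum_succ_mul_add (part μ) (n + k + 1)
  have hn := sum_succ_mul_add (part ν) (n + k + 1)
  have hsm := sum_range_part_of_le μ hK (fun _ x => x) fun _ => rfl
  have hsn := sum_range_part_of_le ν hK (fun _ x => x) fun _ => rfl
  have hm' := sum_range_part μ id
  have hn' := sum_range_part ν id
  rw [Multiset.map_id, μ.parts_sum] at hm'
  rw [Multiset.map_id, ν.parts_sum] at hn'
  simp only [id_eq] at hm' hn'
  rw [hsm, hm', sum_range_part_of_le μ hK (fun i x => (i + 1) * x) fun _ => rfl] at hm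
  rw [hsn, hn', sum_range_part_of_le ν hK (fun i x => (i + 1) * x) fun _ => rfl] at hn
  have hlt : ∑ k ∈ Finset.range (n + k + 1), ∑ i ∈ Finset.range k, part ν i <
      ∑ k ∈ Finset.range (n + k + 1), ∑ i ∈ Finset.range k, part μ i :=
    Finset.sum_lt_sum (fun j _ => h j) ⟨k, by simp, hk⟩
  omega

/-! ### Polynomials in `α` of bounded degree -/

/-- The elements of `ℚ[α]` of degree less than `d`. -/
noncomputable def degLT (d : ℕ) : Submodule ℚ F :=
  (Polynomial.degreeLT ℚ d).map (Algebra.linearMap (Polynomial ℚ) F |>.restrictScalars ℚ)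

theorem mem_degLT {d : ℕ} {a : F} :
    a ∈ degLT d ↔ ∃ p : Polynomial ℚ, p.degree < d ∧ algebraMap (Polynomial ℚ) F p = a := by
  simp [degLT, Polynomial.mem_degreeLT]

theorem degLT_mono {d d' : ℕ} (h : d ≤ d') : degLT d ≤ degLT d' :=
  Submodule.map_mono (Polynomial.degreeLT_mono h)

theorem algebraMap_X : algebraMap (Polynomial ℚ) F Polynomial.X = α := RatFunc.algebraMap_X

theorem α_mul_mem_degLT {d : ℕ} {a : F} (h : a ∈ degLT d) : α * a ∈ degLT (d + 1) := by
  obtain ⟨p, hp, rfl⟩ := mem_degLT.1 h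
  refine mem_degLT.2 ⟨Polynomial.X * p, ?_, by rw [map_mul, algebraMap_X]⟩
  by_cases h0 : p = 0
  · subst h0; simp
  · rw [Polynomial.degree_mul, Polynomial.degree_X, add_comm]
    rw [Polynomial.degree_eq_natDegree h0] at *
    norm_cast at *
    omega

theorem α_pow_mul_mem_degLT {d : ℕ} {a : F} (h : a ∈ degLT d) (k : ℕ) :
    α ^ k * a ∈ degLT (d + k) := by
  induction k with
  | zero => simpa using h
  | succ k ih => rw [pow_succ', mul_assoc]; exact α_mul_mem_degLT ih

theorem natCast_mul_mem_degLT {d : ℕ} {a : F} (h : a ∈ degLT d) (c : ℕ) :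
    a * (c : F) ∈ degLT d := by
  rw [mul_comm, ← nsmul_eq_mul]
  exact nsmul_mem h c

theorem one_mem_degLT : (1 : F) ∈ degLT 1 :=
  mem_degLT.2 ⟨1, by simp, map_one _⟩

theorem mul_mem_degLT {d : ℕ} {a b : F} (ha : a ∈ degLT d) (hb : b ∈ degLT 1) :
    a * b ∈ degLT d := by
  obtain ⟨p, hp, rfl⟩ := mem_degLT.1 hb
  have hp0 : p.degree ≤ 0 := by
    refine Polynomial.degree_le_iff_coeff_zero _ _ |>.2 fun m hm => ?_
    exact (Polynomial.degree_lt_iff_coeff_zero _ _).1 hp m (by exact_mod_cast hm)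
  rw [Polynomial.eq_C_of_degree_le_zero hp0]
  have : algebraMap (Polynomial ℚ) F (Polynomial.C (p.coeff 0)) = algebraMap ℚ F (p.coeff 0) :=
    (IsScalarTower.algebraMap_apply ℚ (Polynomial ℚ) F _).symm
  rw [this, mul_comm, ← Algebra.smul_def]
  exact Submodule.smul_mem _ _ ha

theorem eq_zero_of_mem_degLT_zero {a : F} (h : a ∈ degLT 0) : a = 0 := by
  obtain ⟨p, hp, rfl⟩ := mem_degLT.1 h
  have : p = 0 := by simpa using hp
  simp [this]

theorem eq_zero_of_α_pow_mul_mem {d : ℕ} {c : ℚ} (h : α ^ d * algebraMap ℚ F c ∈ degLT d) :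
    c = 0 := by
  obtain ⟨p, hp, hpe⟩ := mem_degLT.1 h
  have h1 : algebraMap (Polynomial ℚ) F (Polynomial.X ^ d * Polynomial.C c) =
      α ^ d * algebraMap ℚ F c := by
    rw [map_mul, map_pow, algebraMap_X, IsScalarTower.algebraMap_apply ℚ (Polynomial ℚ) F]
    rfl
  rw [← h1] at hpe
  have h2 := RatFunc.algebraMap_injective ℚ hpe
  have h3 : p.coeff d = c := by
    rw [h2, Polynomial.coeff_mul_C, Polynomial.coeff_X_pow_self, one_mul]
  rw [← h3]
  exact Polynomial.coeff_eq_zero_of_degree_lt hp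

theorem e_ne {n : ℕ} {μ ν : n.Partition} (h : Dominates μ ν) (hne : μ ≠ ν) : e μ ≠ e ν := by
  intro hc
  have hlt := sum_succ_mul_part_lt h hne
  simp only [e, ← Nat.cast_pow, ← Nat.cast_sum, ← Nat.cast_add_one, ← Nat.cast_mul] at hc
  generalize ∑ i ∈ Finset.range (len μ), (i + 1) * part μ i = x at *
  generalize ∑ i ∈ Finset.range (len ν), (i + 1) * part ν i = y at *
  generalize ∑ i ∈ Finset.range (len μ), part μ i ^ 2 = u at *
  generalize ∑ i ∈ Finset.range (len ν), part ν i ^ 2 = v at *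
  -- The right side is constant, so comparing powers of `α` forces both sides to vanish.
  have h1 : α * ((u : F) - v) = 2 * ((x : F) - y) :=
    mul_left_cancel₀ α_ne_zero (by linear_combination hc)
  have h2 : (u : ℚ) - v = 0 := by
    apply eq_zero_of_α_pow_mul_mem (d := 1)
    have : α ^ 1 * algebraMap ℚ F ((u : ℚ) - v) = algebraMap ℚ F (2 * ((x : ℚ) - y)) * 1 := by
      simp only [map_sub, map_natCast, map_mul, map_ofNat]; rw [pow_one, h1, mul_one]
    rw [this, ← Algebra.smul_def]
    exact Submodule.smul_mem _ _ one_mem_degLT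
  have h3 : (u : F) - v = 0 := by
    have := congrArg (algebraMap ℚ F) h2
    simpa using this
  rw [h3, mul_zero] at h1
  have h4 : (x : F) = y := by
    have h2 : (2 : F) ≠ 0 := two_ne_zero
    exact sub_eq_zero.1 ((mul_eq_zero.1 h1.symm).resolve_left h2)
  exact hlt.ne (Nat.cast_injective h4)

end Jack

/-! ### Triangularity of `ham j` on the `q_μ`. -/

namespace Jack

/-- The product of the `q_i` over a multiset of indices. -/
noncomputable def qProd (s : Multiset ℕ) : Sym := (s.map qRow).prod

theorem qProd_cons (c : ℕ) (s : Multiset ℕ) : qProd (c ::ₘ s) = qRow c * qProd s := by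
  simp [qProd]

theorem q_eq_qProd {n : ℕ} (μ : n.Partition) : q μ = qProd μ.parts := rfl

/-- Moving units between indices can create zeros; they are harmless because `q_0 = 1`. -/
theorem q_ofSums (n : ℕ) (s : Multiset ℕ) (h : s.sum = n) :
    q (Nat.Partition.ofSums n s h) = qProd s := by
  rw [q_eq_qProd, Nat.Partition.ofSums_parts]
  clear h
  induction s using Multiset.induction_on with
  | empty => rfl
  | cons a s ih =>
    by_cases ha : a = 0
    · subst ha; rw [Multiset.filter_cons_of_neg (p := (· ≠ 0)) _ (by simp), ih, qProd_cons, qRow_zero, one_mul]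
    · rw [Multiset.filter_cons_of_pos (p := (· ≠ 0)) _ ha, qProd_cons, qProd_cons, ih]

theorem excess_ofSums (t n : ℕ) (s : Multiset ℕ) (h : s.sum = n) :
    excess t (Nat.Partition.ofSums n s h).parts = excess t s := by
  rw [Nat.Partition.ofSums_parts]
  clear h
  induction s using Multiset.induction_on with
  | empty => rfl
  | cons a s ih =>
    by_cases ha : a = 0
    · subst ha; rw [Multiset.filter_cons_of_neg (p := (· ≠ 0)) _ (by simp), ih, excess_cons]; simp
    · rw [Multiset.filter_cons_of_pos (p := (· ≠ 0)) _ ha, excess_cons, excess_cons, ih]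

/-- Weak dominance of multisets of natural numbers. -/
def MDominates (s r : Multiset ℕ) : Prop := s.sum = r.sum ∧ ∀ t, excess t r ≤ excess t s

/-- Strictness of a dominance relation. -/
def ExcessLT (r s : Multiset ℕ) : Prop := ∃ t, excess t r < excess t s

theorem MDominates.refl (s : Multiset ℕ) : MDominates s s := ⟨rfl, fun _ => le_rfl⟩

theorem MDominates.trans {s r u : Multiset ℕ} (h : MDominates s r) (h' : MDominates r u) :
    MDominates s u :=
  ⟨h.1.trans h'.1, fun t => (h'.2 t).trans (h.2 t)⟩

/-- The combinations of the `E_c q_s` with `(c, s)` dominating `r`, the coefficients being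
polynomials in `α` of degree less than `d` unless the dominance is strict. -/
noncomputable def lowV (d : ℕ) (r : Multiset ℕ) : AddSubgroup SymV :=
  AddSubgroup.closure {x | ∃ (a : F) (c : ℕ) (s : Multiset ℕ), MDominates (c ::ₘ s) r ∧
    (a ∈ degLT d ∨ ExcessLT r (c ::ₘ s)) ∧ x = a • (rowV c * Polynomial.C (qProd s))}

theorem mem_lowV {d : ℕ} {r : Multiset ℕ} {a : F} {c : ℕ} {s : Multiset ℕ}
    (h : MDominates (c ::ₘ s) r) (h' : a ∈ degLT d ∨ ExcessLT r (c ::ₘ s)) :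
    a • (rowV c * Polynomial.C (qProd s)) ∈ lowV d r :=
  AddSubgroup.subset_closure ⟨a, c, s, h, h', rfl⟩

theorem lowV_mono {d d' : ℕ} {r r' : Multiset ℕ} (hd : d ≤ d') (h : MDominates r r') :
    lowV d r ≤ lowV d' r' := by
  refine (AddSubgroup.closure_le _).2 ?_
  rintro _ ⟨a, c, s, h1, h2, rfl⟩
  refine mem_lowV (h1.trans h) (h2.imp (fun h => degLT_mono hd h) ?_)
  rintro ⟨t, ht⟩
  exact ⟨t, (h.2 t).trans_lt ht⟩

theorem smul_mem_lowV {d : ℕ} {r r' : Multiset ℕ} {a : F} {x : SymV} (hx : x ∈ lowV 1 r)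
    (h : MDominates r r') (h' : a ∈ degLT d ∨ ExcessLT r' r) : a • x ∈ lowV d r' := by
  induction hx using AddSubgroup.closure_induction with
  | mem x hx =>
    obtain ⟨b, c, s, h1, h2, rfl⟩ := hx
    rw [smul_smul]
    refine mem_lowV (h1.trans h) ?_
    rcases h' with h' | ⟨t, ht⟩
    · rcases h2 with h2 | ⟨t, ht⟩
      · exact Or.inl (mul_mem_degLT h' h2)
      · exact Or.inr ⟨t, (h.2 t).trans_lt ht⟩
    · exact Or.inr ⟨t, ht.trans_le (h1.2 t)⟩
  | zero => rw [smul_zero]; exact zero_mem _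
  | add x y _ _ hx hy => rw [smul_add]; exact add_mem hx hy
  | neg x _ hx => rw [smul_neg]; exact neg_mem hx

theorem mDominates_pair {c m c' m' : ℕ} (h : c' + m' = c + m) (hc : c ≤ c') (hm : m ≤ c')
    (s : Multiset ℕ) : MDominates (c' ::ₘ m' ::ₘ s) (c ::ₘ m ::ₘ s) := by
  refine ⟨by simp only [Multiset.sum_cons]; omega, fun t => ?_⟩
  simp only [excess_cons]
  omega

theorem excessLT_pair {c m c' m' : ℕ} (h : c' + m' = c + m) (hc : c < c') (hm : m < c')
    (s : Multiset ℕ) : ExcessLT (c ::ₘ m ::ₘ s) (c' ::ₘ m' ::ₘ s) := by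
  refine ⟨max c m, ?_⟩
  simp only [excess_cons]
  omega

/-- `rowV_mul_rowV` replaces `(c, m + 1)` by `(c + 1, m)`, and all terms other than `E_{m+1} q_c`
have strictly more spread indices. The bound 0 on the degree allows only strictly dominating terms
with nonzero coefficient. -/
theorem mul_mem_lowV_of_le (m : ℕ) : ∀ (c : ℕ) (_ : m ≤ c) (s : Multiset ℕ),
    rowV c * rowV m * Polynomial.C (qProd s) + rowV m * Polynomial.C (qProd (c ::ₘ s)) ∈
      lowV 0 (c ::ₘ m ::ₘ s) := by
  induction m with
  | zero =>
    intro c _ s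
    simp only [rowV_zero, mul_zero, zero_mul, add_zero]
    exact zero_mem _
  | succ m ih =>
    intro c hc s
    have h1 := lowV_mono le_rfl (mDominates_pair (c := c) (m := m + 1) (c' := c + 1) (m' := m)
      (by omega) (by omega) (by omega) s) (ih (c + 1) (by omega) s)
    have h2 : (1 : F) • (rowV (c + 1) * Polynomial.C (qProd (m ::ₘ s))) ∈
        lowV 0 (c ::ₘ (m + 1) ::ₘ s) :=
      mem_lowV (mDominates_pair (by omega) (by omega) (by omega) s)
        (Or.inr (excessLT_pair (by omega) (by omega) (by omega) s))
    have h3 : (1 : F) • (rowV m * Polynomial.C (qProd ((c + 1) ::ₘ s))) ∈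
        lowV 0 (c ::ₘ (m + 1) ::ₘ s) := by
      refine mem_lowV ?_ (Or.inr ?_) <;> rw [Multiset.cons_swap m (c + 1) s]
      · exact mDominates_pair (by omega) (by omega) (by omega) s
      · exact excessLT_pair (by omega) (by omega) (by omega) s
    rw [one_smul] at h2 h3
    convert sub_mem (add_mem h1 h2) h3 using 1
    rw [rowV_mul_rowV]
    simp only [qProd_cons, Polynomial.C_mul]
    ring

theorem rowV_mul_rowV_mem_lowV (c m : ℕ) (s : Multiset ℕ) :
    rowV c * rowV m * Polynomial.C (qProd s) +
      rowV (min c m) * Polynomial.C (qProd (max c m ::ₘ s)) ∈ lowV 0 (c ::ₘ m ::ₘ s) := by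
  rcases le_total m c with h | h
  · rw [min_eq_right h, max_eq_left h]
    exact mul_mem_lowV_of_le m c h s
  · rw [min_eq_left h, max_eq_right h, mul_comm (rowV c), Multiset.cons_swap]
    exact mul_mem_lowV_of_le c m h s

theorem rowV_mul_rowV_mem_lowV_one (c m : ℕ) (s : Multiset ℕ) :
    rowV c * rowV m * Polynomial.C (qProd s) ∈ lowV 1 (c ::ₘ m ::ₘ s) := by
  have h1 := lowV_mono (Nat.zero_le 1) (MDominates.refl _) (rowV_mul_rowV_mem_lowV c m s)
  have h2 : (1 : F) • (rowV (min c m) * Polynomial.C (qProd (max c m ::ₘ s))) ∈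
      lowV 1 (c ::ₘ m ::ₘ s) := by
    refine mem_lowV ?_ (Or.inl one_mem_degLT)
    rw [Multiset.cons_swap]
    exact mDominates_pair (max_add_min c m) (le_max_left _ _) (le_max_right _ _) s
  rw [one_smul] at h2
  have h3 := sub_mem h1 h2
  rwa [add_sub_cancel_right] at h3

/-- The Leibniz rule together with `grad q_m = E_m`. -/
theorem grad_qProd (s : Multiset ℕ) :
    grad (qProd s) = (s.map fun m => rowV m * Polynomial.C (qProd (s.erase m))).sum := by
  induction s using Multiset.induction_on with
  | empty => simp [qProd]
  | cons a s ih =>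
    rw [qProd_cons, Derivation.leibniz, ih, Multiset.map_cons, Multiset.sum_cons,
      Multiset.erase_cons_head, grad_qRow, add_comm, Polynomial.smul_eq_C_mul,
      Polynomial.smul_eq_C_mul, mul_comm (Polynomial.C (qProd s)), ← Multiset.sum_map_mul_left]
    refine congrArg₂ _ rfl (congrArg Multiset.sum (Multiset.map_congr rfl fun m hm => ?_))
    by_cases h : m = a
    · subst h
      rw [Multiset.erase_cons_head]
      conv_rhs => rw [← Multiset.cons_erase hm, qProd_cons, Polynomial.C_mul]
      ring
    · rw [Multiset.erase_cons_tail _ (Ne.symm h), qProd_cons, Polynomial.C_mul]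
      ring

theorem lax_rowV_mul (c : ℕ) (s : Multiset ℕ) :
    lax (rowV c * Polynomial.C (qProd s)) =
      (α * (c : F) - 1) • (rowV c * Polynomial.C (qProd s)) +
        (s.map fun m => rowV c * rowV m * Polynomial.C (qProd (s.erase m))).sum := by
  rw [lax_mul_C, lax_rowV, grad_qProd, smul_mul_assoc, ← Multiset.sum_map_mul_left]
  simp only [mul_assoc]

theorem sum_map_mem {M ι : Type*} [AddCommGroup M] (G : AddSubgroup M) (s : Multiset ι)
    (f : ι → M) (h : ∀ i ∈ s, f i ∈ G) : (s.map f).sum ∈ G :=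
  multiset_sum_mem _ fun x hx => by
    obtain ⟨i, hi, rfl⟩ := Multiset.mem_map.1 hx
    exact h i hi

theorem lax_rowV_mul_sub_mem (c : ℕ) (s : Multiset ℕ) :
    lax (rowV c * Polynomial.C (qProd s)) - (α * (c : F)) • (rowV c * Polynomial.C (qProd s)) ∈
      lowV 1 (c ::ₘ s) := by
  have h1 : (1 : F) • (rowV c * Polynomial.C (qProd s)) ∈ lowV 1 (c ::ₘ s) :=
    mem_lowV (MDominates.refl _) (Or.inl one_mem_degLT)
  have h2 : (s.map fun m => rowV c * rowV m * Polynomial.C (qProd (s.erase m))).sum ∈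
      lowV 1 (c ::ₘ s) := by
    refine sum_map_mem _ _ _ fun m hm => ?_
    have := rowV_mul_rowV_mem_lowV_one c m (s.erase m)
    rwa [Multiset.cons_erase hm] at this
  convert sub_mem h2 h1 using 1
  rw [lax_rowV_mul, sub_smul]
  abel

/-- Only the eigenvalue `αc - 1` brings in a power of `α`, so one application of `lax` raises the
degree bound by one. -/
theorem lax_mem_lowV {d : ℕ} {r : Multiset ℕ} {x : SymV} (hx : x ∈ lowV d r) :
    lax x ∈ lowV (d + 1) r := by
  induction hx using AddSubgroup.closure_induction with
  | mem x hx =>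
    obtain ⟨a, c, s, h1, h2, rfl⟩ := hx
    have h3 := smul_mem_lowV (lax_rowV_mul_sub_mem c s) h1 h2
    have h4 : (a * (α * (c : F))) • (rowV c * Polynomial.C (qProd s)) ∈ lowV (d + 1) r := by
      refine mem_lowV h1 (h2.imp_left fun h => ?_)
      rw [← mul_assoc, mul_comm a]
      exact natCast_mul_mem_degLT (α_mul_mem_degLT h) c
    convert add_mem (lowV_mono (Nat.le_succ d) (MDominates.refl _) h3) h4 using 1
    rw [map_smul, smul_sub, smul_smul]
    abel
  | zero => rw [map_zero]; exact zero_mem _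
  | add x y _ _ hx hy => rw [map_add]; exact add_mem hx hy
  | neg x _ hx => rw [map_neg]; exact neg_mem hx

theorem lax_pow_rowV_mul_sub_mem (j c : ℕ) (s : Multiset ℕ) :
    (lax ^ j) (rowV c * Polynomial.C (qProd s)) -
      (α * (c : F)) ^ j • (rowV c * Polynomial.C (qProd s)) ∈ lowV j (c ::ₘ s) := by
  induction j with
  | zero => simp
  | succ j ih =>
    have h1 := lax_mem_lowV ih
    have h2 : (α * (c : F)) ^ j ∈ degLT (j + 1) := by
      have := natCast_mul_mem_degLT (α_pow_mul_mem_degLT one_mem_degLT j) (c ^ j)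
      rw [mul_one, Nat.cast_pow, ← mul_pow, add_comm] at this
      exact this
    have h3 := smul_mem_lowV (lax_rowV_mul_sub_mem c s) (MDominates.refl _) (Or.inl h2)
    convert add_mem h1 h3 using 1
    rw [pow_succ' lax, Module.End.mul_apply, map_sub, map_smul, smul_sub, smul_smul, ← pow_succ]
    abel

/-- The span of the `q_μ` with `μ` strictly dominating `ν`. -/
noncomputable def qAbove {n : ℕ} (ν : n.Partition) : Submodule F Sym :=
  Submodule.span F (q '' {μ | Dominates μ ν ∧ μ ≠ ν})

theorem restrict_gradAdj_smul (a : F) (g : SymV) : gradAdj (a • g) = a • gradAdj g :=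
  (gradAdj.restrictScalars F).map_smul a g

theorem gradAdj_rowV_mul (c : ℕ) (s : Multiset ℕ) :
    gradAdj (rowV c * Polynomial.C (qProd s)) = (α * (c : F)) • qProd (c ::ₘ s) := by
  rw [gradAdj_mul_C, gradAdj_rowV, qProd_cons, smul_mul_assoc]

/-- `gradAdj` sends `E_c q_s` to `αc` times the product of all the `q`'s. Terms that rearrange to
`ν` are not strictly dominating, so their coefficients obey the degree bound. -/
theorem gradAdj_lowV {d n : ℕ} (ν : n.Partition) {x : SymV} (hx : x ∈ lowV d ν.parts) :
    ∃ a ∈ degLT d, gradAdj x - (α * a) • q ν ∈ qAbove ν := by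
  induction hx using AddSubgroup.closure_induction with
  | mem x hx =>
    obtain ⟨a, c, s, h1, h2, rfl⟩ := hx
    have hsum : (c ::ₘ s).sum = n := h1.1.trans ν.parts_sum
    rw [restrict_gradAdj_smul, gradAdj_rowV_mul, ← q_ofSums n _ hsum, smul_smul]
    have hex := fun t => excess_ofSums t n _ hsum
    generalize Nat.Partition.ofSums n (c ::ₘ s) hsum = μ at *
    by_cases h : μ = ν
    · subst h
      refine ⟨a * c, ?_, ?_⟩
      · rcases h2 with h2 | ⟨t, ht⟩
        · exact natCast_mul_mem_degLT h2 c
        · rw [hex] at ht; exact absurd ht (lt_irrefl _)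
      · rw [show a * (α * (c : F)) = α * (a * c) by ring, sub_self]
        exact zero_mem _
    · refine ⟨0, zero_mem _, ?_⟩
      rw [mul_zero, zero_smul, sub_zero]
      refine Submodule.smul_mem _ _ (Submodule.subset_span ⟨μ, ⟨?_, h⟩, rfl⟩)
      exact dominates_of_excess fun t => (h1.2 t).trans_eq (hex t).symm
  | zero => exact ⟨0, zero_mem _, by simp⟩
  | add x y _ _ hx hy =>
    obtain ⟨a, ha, hx⟩ := hx
    obtain ⟨b, hb, hy⟩ := hy
    refine ⟨a + b, add_mem ha hb, ?_⟩
    convert add_mem hx hy using 1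
    rw [map_add, mul_add, add_smul]
    abel
  | neg x _ hx =>
    obtain ⟨a, ha, hx⟩ := hx
    refine ⟨-a, neg_mem ha, ?_⟩
    convert neg_mem hx using 1
    rw [map_neg, mul_neg, neg_smul]
    abel

theorem map_multiset_sum_map {M N ι : Type*} [AddCommMonoid M] [AddCommMonoid N] (φ : M →+ N)
    (s : Multiset ι) (f : ι → M) : φ (s.map f).sum = (s.map fun i => φ (f i)).sum := by
  rw [map_multiset_sum, Multiset.map_map]; rfl

theorem multiset_sum_map_smul {ι : Type*} (s : Multiset ι) (f : ι → F) (x : Sym) :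
    (s.map fun i => f i • x).sum = (s.map f).sum • x := by
  induction s using Multiset.induction_on with
  | empty => simp
  | cons a s ih => simp only [Multiset.map_cons, Multiset.sum_cons, ih, add_smul]

/-- The `k`-th power sum of the parts of a partition. -/
def partPow {n : ℕ} (ν : n.Partition) (k : ℕ) : ℕ := (ν.parts.map fun i => i ^ k).sum

/-- Each part `m` contributes `(αm)^j` from `lax ^ j` and `αm` from `gradAdj`; everything else is of
lower degree in `α` or strictly above `ν`. -/
theorem ham_q_sub_mem (j : ℕ) {n : ℕ} (ν : n.Partition) :
    ∃ a ∈ degLT j, ham j (q ν) - (α ^ (j + 1) * (partPow ν (j + 1) : F) + α * a) • q ν ∈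
      qAbove ν := by
  have h1 : (ν.parts.map fun m : ℕ => (lax ^ j) (rowV m * Polynomial.C (qProd (ν.parts.erase m))) -
      (α * (m : F)) ^ j • (rowV m * Polynomial.C (qProd (ν.parts.erase m)))).sum ∈
      lowV j ν.parts := by
    refine sum_map_mem _ _ _ fun m hm => ?_
    have := lax_pow_rowV_mul_sub_mem j m (ν.parts.erase m)
    rwa [Multiset.cons_erase hm] at this
  obtain ⟨a, ha, h2⟩ := gradAdj_lowV ν h1
  refine ⟨a, ha, ?_⟩
  convert h2 using 1
  have h3 : gradAdj (ν.parts.map fun m : ℕ => (α * (m : F)) ^ j • (rowV m *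
      Polynomial.C (qProd (ν.parts.erase m)))).sum =
      (α ^ (j + 1) * (partPow ν (j + 1) : F)) • q ν := by
    have := map_multiset_sum_map gradAdj.toAddMonoidHom ν.parts
      fun m : ℕ => (α * (m : F)) ^ j • (rowV m * Polynomial.C (qProd (ν.parts.erase m)))
    refine this.trans ?_
    have h4 : ∀ m ∈ ν.parts, gradAdj ((α * (m : F)) ^ j • (rowV m *
        Polynomial.C (qProd (ν.parts.erase m)))) = (α * (m : F)) ^ (j + 1) • q ν := by
      intro m hm
      rw [restrict_gradAdj_smul, gradAdj_rowV_mul, Multiset.cons_erase hm, smul_smul, ← pow_succ]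
      rfl
    refine (congrArg Multiset.sum (Multiset.map_congr rfl h4)).trans ?_
    rw [multiset_sum_map_smul]
    congr 1
    simp only [mul_pow, Multiset.sum_map_mul_left, partPow]
    congr 1
    have := map_multiset_sum_map (Nat.castAddMonoidHom F) ν.parts fun i => i ^ (j + 1)
    refine Eq.trans ?_ this.symm
    simp
  rw [Multiset.sum_map_sub, map_sub, h3, ham_apply, q_eq_qProd ν, grad_qProd, add_smul]
  have h5 := map_multiset_sum_map (lax ^ j).toAddMonoidHom ν.parts
      fun m => rowV m * Polynomial.C (qProd (ν.parts.erase m))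
  have h6 : (lax ^ j) (ν.parts.map fun m => rowV m * Polynomial.C (qProd (ν.parts.erase m))).sum =
    (ν.parts.map fun m : ℕ => (lax ^ j) (rowV m * Polynomial.C (qProd (ν.parts.erase m)))).sum := h5
  rw [h6]
  abel

/-- For `j = 1` the lower-order part is explicit: `αm - 1` from the eigenvalue of `E_m` and `-E_min
q_max` for each ordered pair of distinct positions. The `-1` supplies the pairs of equal positions
in the sum of minima. -/
theorem ham_one_q_sub_mem {n : ℕ} (ν : n.Partition) :
    ham 1 (q ν) - e ν • q ν ∈ qAbove ν := by
  set s := ν.parts with hs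
  -- After removal of all diagonal contributions the remainder lies in `lowV 0`, hence contributes
  -- nothing to `q ν`.
  have h1 : (s.map fun m : ℕ => lax (rowV m * Polynomial.C (qProd (s.erase m))) -
      (α * (m : F) - 1) • (rowV m * Polynomial.C (qProd (s.erase m))) +
      ((s.erase m).map fun i => rowV (min m i) *
        Polynomial.C (qProd (max m i ::ₘ (s.erase m).erase i))).sum).sum ∈ lowV 0 s := by
    refine sum_map_mem _ _ _ fun m hm => ?_
    rw [lax_rowV_mul, add_sub_cancel_left, ← Multiset.sum_map_add]
    refine sum_map_mem _ _ _ fun i hi => ?_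
    have := rowV_mul_rowV_mem_lowV m i ((s.erase m).erase i)
    rwa [Multiset.cons_erase hi, Multiset.cons_erase hm] at this
  obtain ⟨a, ha, h2⟩ := gradAdj_lowV ν h1
  rw [eq_zero_of_mem_degLT_zero ha, mul_zero, zero_smul, sub_zero] at h2
  convert h2 using 1
  rw [Multiset.sum_map_add, Multiset.sum_map_sub, map_add, map_sub]
  have h3 : gradAdj (s.map fun m : ℕ => (α * (m : F) - 1) • (rowV m *
      Polynomial.C (qProd (s.erase m)))).sum =
      (s.map fun m : ℕ => (α * (m : F) - 1) * (α * m)).sum • q ν := by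
    refine (map_multiset_sum_map gradAdj.toAddMonoidHom s _).trans ?_
    rw [← multiset_sum_map_smul]
    refine congrArg Multiset.sum (Multiset.map_congr rfl fun m hm => ?_)
    change gradAdj _ = _
    rw [restrict_gradAdj_smul, gradAdj_rowV_mul, Multiset.cons_erase hm, smul_smul]
    rfl
  have h4 : gradAdj (s.map fun m => ((s.erase m).map fun i => rowV (min m i) *
        Polynomial.C (qProd (max m i ::ₘ (s.erase m).erase i))).sum).sum =
      (s.map fun m : ℕ => ((s.erase m).map fun i => α * ((min m i : ℕ) : F)).sum).sum • q ν := by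
    refine (map_multiset_sum_map gradAdj.toAddMonoidHom s _).trans ?_
    rw [← multiset_sum_map_smul]
    refine congrArg Multiset.sum (Multiset.map_congr rfl fun m hm => ?_)
    refine (map_multiset_sum_map gradAdj.toAddMonoidHom _ _).trans ?_
    rw [← multiset_sum_map_smul]
    refine congrArg Multiset.sum (Multiset.map_congr rfl fun i hi => ?_)
    change gradAdj _ = _
    rw [gradAdj_rowV_mul]
    congr 1
    rw [q_eq_qProd, ← hs, ← Multiset.cons_erase hm, ← Multiset.cons_erase hi]
    simp only [qProd_cons, Multiset.erase_cons_head]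
    rcases le_total m i with h | h
    · rw [min_eq_left h, max_eq_right h]
    · rw [min_eq_right h, max_eq_left h]; ring
  have h5 : lax (s.map fun m => rowV m * Polynomial.C (qProd (s.erase m))).sum =
      (s.map fun m : ℕ => lax (rowV m * Polynomial.C (qProd (s.erase m)))).sum :=
    map_multiset_sum_map lax.toAddMonoidHom s _
  rw [h3, h4, ham_apply, q_eq_qProd ν, grad_qProd, ← hs, pow_one, h5, sub_add, ← sub_smul]
  congr 2
  rw [e_eq]
  have h6 : ∀ m ∈ s, ((s.erase m).map fun i => α * ((min m i : ℕ) : F)).sum =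
      α * (s.map fun i => ((min m i : ℕ) : F)).sum - α * m := by
    intro m hm
    conv_rhs => rw [← Multiset.cons_erase hm]
    rw [Multiset.map_cons, Multiset.sum_cons, Multiset.sum_map_mul_left, min_self]
    ring
  rw [Multiset.map_congr rfl h6, Multiset.sum_map_sub, Multiset.sum_map_mul_left]
  have h7 : (s.map fun m : ℕ => (α * (m : F) - 1) * (α * m)).sum =
      α ^ 2 * (s.map fun m : ℕ => (m : F) ^ 2).sum - (s.map fun m : ℕ => α * (m : F)).sum := by
    rw [← Multiset.sum_map_mul_left, ← Multiset.sum_map_sub]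
    congr 2
    ext m
    ring
  have h8 : ∀ (f : ℕ → ℕ) (u : Multiset ℕ), ((u.map f).sum : F) = (u.map fun i => (f i : F)).sum :=
    fun f u => map_multiset_sum_map (Nat.castAddMonoidHom F) u f
  rw [h7, h8, h8, ← hs]
  simp only [h8, Nat.cast_pow]
  ring

end Jack

/-! ### Identification of `D` with `ham 1`. -/

namespace Jack

open MvPolynomial

theorem pderiv_comm (i j : ℕ+) (f : Sym) :
    pderiv i (pderiv j f) = pderiv j (pderiv i f) := by
  have : ⁅(pderiv i : Derivation F Sym Sym), (pderiv j : Derivation F Sym Sym)⁆ = 0 := by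
    apply derivation_ext
    intro k
    simp [Derivation.commutator_apply, pderiv_X, Pi.single_apply, apply_ite]
  have h2 := congrArg (fun A : Derivation F Sym Sym => A f) this
  simpa [Derivation.commutator_apply, sub_eq_zero] using h2

theorem grad_eq_sum (s : Finset ℕ+) (f : Sym) (hs : ∀ l, l ∉ s → pderiv l f = 0) :
    grad f = ∑ k ∈ s, Polynomial.monomial (k : ℕ) ((α * (k : ℕ)) • pderiv k f) := by
  ext1 m
  rw [Polynomial.finsetSum_coeff]
  rcases Nat.eq_zero_or_pos m with rfl | h
  · rw [coeff_grad_zero, Finset.sum_eq_zero]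
    intro k _
    rw [Polynomial.coeff_monomial, if_neg k.ne_zero]
  · lift m to ℕ+ using h
    rw [coeff_grad_pnat]
    simp only [Polynomial.coeff_monomial, PNat.coe_inj, Finset.sum_ite_eq']
    split_ifs with hm
    · rfl
    · rw [hs m hm, smul_zero]

theorem pw_coe (k : ℕ+) : pw k = X k := by simp [pw]

theorem gradAdj_X_pow_mul_grad (s : Finset ℕ+) (k : ℕ+) (f : Sym)
    (hs : ∀ l, l ∉ s → pderiv l f = 0) :
    gradAdj (Polynomial.X ^ (k : ℕ) * grad f) =
      ∑ l ∈ s, (α * (l : ℕ)) • (X (k + l) * pderiv l f) := by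
  rw [grad_eq_sum s f hs, Finset.mul_sum, map_sum]
  refine Finset.sum_congr rfl fun l _ => ?_
  rw [Polynomial.X_pow_mul_monomial, gradAdj_monomial, if_neg (by positivity), mul_smul_comm,
    add_comm, ← PNat.add_coe, pw_coe]

/-- The three summands of `lax` give the three sums of `D`: lowering the power of `v` splits `p_k`,
the gradient joins two power sums, and the diagonal gives the last term. -/
theorem ham_one_eq_sum (s : Finset ℕ+) (f : Sym) (hs : ∀ l, l ∉ s → pderiv l f = 0) :
    ham 1 f = (∑ k ∈ s, ∑ m ∈ Finset.Ico 1 (k : ℕ),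
        (α * (k : ℕ)) • (pw m * pw (k - m) * pderiv k f)) +
      ∑ k ∈ s, ∑ l ∈ s, joinTerm (l, k) f + (α * (α - 1)) • ∑ k ∈ s, diagTerm k f := by
  have hlax : ∀ k ∈ s, gradAdj (lax (Polynomial.monomial (k : ℕ) ((α * (k : ℕ)) • pderiv k f))) =
      (∑ m ∈ Finset.Ico 1 (k : ℕ), (α * (k : ℕ)) • (pw m * pw (k - m) * pderiv k f)) +
      ∑ l ∈ s, joinTerm (l, k) f + (α * (α - 1)) • diagTerm k f := by
    intro k _
    rw [lax_monomial, map_add, map_add, map_sum, restrict_gradAdj_smul, gradAdj_monomial,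
      if_neg k.ne_zero, gradAdj_X_pow_mul_grad s k _ fun l hl => by
        rw [Derivation.map_smul, pderiv_comm, hs l hl, map_zero, smul_zero], add_comm, add_assoc]
    congr 1
    · refine Finset.sum_congr rfl fun m hm => ?_
      rw [gradAdj_monomial, if_neg (by have := (Finset.mem_Ico.1 hm).1; omega), mul_smul_comm,
        mul_smul_comm, mul_assoc]
    · congr 1
      · refine Finset.sum_congr rfl fun l _ => ?_
        rw [joinTerm, Derivation.map_smul, mul_smul_comm, smul_smul, add_comm k l]
        congr 1
        ring
      · rw [diagTerm, pw_coe, mul_smul_comm, smul_smul, smul_smul]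
        congr 1
        ring
  rw [ham_apply, pow_one, grad_eq_sum s f hs, map_sum, map_sum, Finset.sum_congr rfl hlax,
    Finset.sum_add_distrib, Finset.sum_add_distrib, Finset.smul_sum]

theorem sum_splitTerm (N : ℕ+) (f : Sym) :
    ∑ ij ∈ (Finset.Iic N ×ˢ Finset.Iic N).filter (fun ij => ij.1 + ij.2 ≤ N), splitTerm ij f =
      ∑ k ∈ Finset.Iic N, ∑ m ∈ Finset.Ico 1 (k : ℕ),
        (α * (k : ℕ)) • (pw m * pw (k - m) * pderiv k f) := by
  rw [Finset.sum_sigma']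
  refine Finset.sum_bij' (fun ij _ => ⟨ij.1 + ij.2, (ij.1 : ℕ)⟩)
    (fun x _ => (x.2.toPNat', ((x.1 : ℕ) - x.2).toPNat')) ?_ ?_ ?_ ?_ ?_
  · rintro ⟨i, j⟩ h
    simp only [Finset.mem_filter] at h
    simp only [Finset.mem_sigma, Finset.mem_Iic, Finset.mem_Ico, PNat.add_coe]
    exact ⟨h.2, i.pos, Nat.lt_add_of_pos_right j.pos⟩
  · rintro ⟨k, m⟩ h
    simp only [Finset.mem_sigma, Finset.mem_Iic, Finset.mem_Ico] at h
    obtain ⟨h1, h2, h3⟩ := h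
    have h4 : (m.toPNat' : ℕ) = m := by simp; omega
    have h5 : (((k : ℕ) - m).toPNat' : ℕ) = k - m := by simp; omega
    simp only [Finset.mem_filter, Finset.mem_product, Finset.mem_Iic, ← PNat.coe_le_coe,
      PNat.add_coe, h4, h5] at *
    omega
  · rintro ⟨i, j⟩ _
    simp
  · rintro ⟨k, m⟩ h
    simp only [Finset.mem_sigma, Finset.mem_Iic, Finset.mem_Ico] at h
    obtain ⟨h1, h2, h3⟩ := h
    have h4 : (m.toPNat' : ℕ) = m := by simp; omega
    have h5 : (((k : ℕ) - m).toPNat' : ℕ) = k - m := by simp; omega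
    simp only [h4, Sigma.mk.injEq, heq_eq_eq, and_true]
    rw [← PNat.coe_inj, PNat.add_coe, h4, h5]
    omega
  · rintro ⟨i, j⟩ _
    simp only [splitTerm, PNat.add_coe, Nat.add_sub_cancel_left, pw_coe, Nat.cast_add]
    rw [mul_comm α]

theorem exists_pderiv_bound (f : Sym) : ∃ N : ℕ+, ∀ l, l ∉ Finset.Iic N → pderiv l f = 0 := by
  obtain ⟨N, hN⟩ := f.vars.bddAbove
  refine ⟨N, fun l hl => pderiv_eq_zero_of_notMem_vars fun h => hl ?_⟩
  exact Finset.mem_Iic.2 (hN h)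

theorem D_eq_ham (f : Sym) : D f = ham 1 f := by
  classical
  obtain ⟨N, hN⟩ := exists_pderiv_bound f
  rw [ham_one_eq_sum _ f hN, ← sum_splitTerm]
  change ∑ᶠ ij : ℕ+ × ℕ+, splitTerm ij f + ∑ᶠ ij : ℕ+ × ℕ+, joinTerm ij f +
    (α * (α - 1)) • ∑ᶠ k : ℕ+, diagTerm k f = _
  congr 1
  · congr 1
    · refine finsum_eq_sum_of_support_subset _ fun ij h => ?_
      have h1 : ij.1 + ij.2 ∈ Finset.Iic N := by
        by_contra hc
        exact h (by simp [splitTerm, hN _ hc])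
      rw [Finset.mem_Iic] at h1
      simp only [Finset.coe_filter, Set.mem_ofPred_eq, Finset.mem_product, Finset.mem_Iic]
      exact ⟨⟨(PNat.lt_add_right _ _).le.trans h1, (PNat.lt_add_left _ _).le.trans h1⟩, h1⟩
    · rw [Finset.sum_comm, ← Finset.sum_product']
      refine finsum_eq_sum_of_support_subset _ fun ij h => ?_
      rw [Finset.mem_coe, Finset.mem_product]
      constructor
      · by_contra hc
        exact h (by simp [joinTerm, pderiv_comm ij.1, hN _ hc])
      · by_contra hc
        exact h (by simp [joinTerm, hN _ hc])
  · congr 1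
    refine finsum_eq_sum_of_support_subset _ fun k h => ?_
    by_contra hc
    exact h (by simp [diagTerm, hN _ hc])

end Jack

namespace Jack

/-! ### Orthogonalization of a triangular family -/

section Orthogonalization

variable {K V ι : Type*} [Field K] [AddCommGroup V] [Module K V] [PartialOrder ι]

theorem span_Ioi_le_Ici (q : ι → V) (i : ι) :
    Submodule.span K (q '' Set.Ioi i) ≤ Submodule.span K (q '' Set.Ici i) :=
  Submodule.span_mono (Set.image_mono Set.Ioi_subset_Ici_self)

theorem span_Ici_anti (q : ι → V) {i j : ι} (h : i ≤ j) :
    Submodule.span K (q '' Set.Ici j) ≤ Submodule.span K (q '' Set.Ici i) :=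
  Submodule.span_mono (Set.image_mono (Set.Ici_subset_Ici.2 h))

theorem self_mem_span_Ici (q : ι → V) (i : ι) : q i ∈ Submodule.span K (q '' Set.Ici i) :=
  Submodule.subset_span ⟨i, Set.self_mem_Ici, rfl⟩

/-- Back substitution from the maximal elements downwards: no diagonal entry of `T - c` vanishes
above `j`. -/
theorem mem_map_sub_of_triangular [Finite ι] {q : ι → V} {T : V →ₗ[K] V} {τ : ι → K}
    (hT : ∀ i, T (q i) - τ i • q i ∈ Submodule.span K (q '' Set.Ioi i)) (c : K) (j : ι)
    (hj : ∀ k, j ≤ k → τ k ≠ c) :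
    q j ∈ (Submodule.span K (q '' Set.Ici j)).map (T - c • LinearMap.id) := by
  induction j using WellFoundedGT.induction with
  | ind j ih =>
    have h1 : Submodule.span K (q '' Set.Ioi j) ≤
        (Submodule.span K (q '' Set.Ici j)).map (T - c • LinearMap.id) := by
      refine Submodule.span_le.2 ?_
      rintro _ ⟨k, hk, rfl⟩
      have hk : j < k := hk
      exact Submodule.map_mono (span_Ici_anti q hk.le) (ih k hk fun l hl => hj l (hk.le.trans hl))
    have h2 := Submodule.mem_map_of_mem (f := T - c • LinearMap.id)
      (self_mem_span_Ici (K := K) q j)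
    have h3 := Submodule.smul_mem _ (τ j - c)⁻¹ (sub_mem h2 (h1 (hT j)))
    convert h3 using 1
    have h4 : (T - c • LinearMap.id : V →ₗ[K] V) (q j) - (T (q j) - τ j • q j) = (τ j - c) • q j := by
      simp [sub_smul]
    rw [h4, smul_smul, inv_mul_cancel₀ (sub_ne_zero.2 (hj j le_rfl)), one_smul]

theorem exists_eigenvector_of_triangular [Finite ι] {q : ι → V} {T : V →ₗ[K] V} {τ : ι → K}
    (hT : ∀ i, T (q i) - τ i • q i ∈ Submodule.span K (q '' Set.Ioi i)) (i : ι)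
    (hi : ∀ k, i < k → τ k ≠ τ i) :
    ∃ x, x - q i ∈ Submodule.span K (q '' Set.Ioi i) ∧ T x = τ i • x := by
  have h1 : Submodule.span K (q '' Set.Ioi i) ≤
      (Submodule.span K (q '' Set.Ioi i)).map (T - τ i • LinearMap.id) := by
    refine Submodule.span_le.2 ?_
    rintro _ ⟨k, hk, rfl⟩
    have hk : i < k := hk
    refine Submodule.map_mono ?_
      (mem_map_sub_of_triangular hT (τ i) k fun l hl => hi l (hk.trans_le hl))
    exact Submodule.span_mono (Set.image_mono (Set.Ici_subset_Ioi.2 hk))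
  -- `T - τ i` is onto the span strictly above `i`, so the error of `q i` as an eigenvector can be
  -- corrected there.
  obtain ⟨w, hw, hw'⟩ := h1 (hT i)
  refine ⟨q i - w, ?_, ?_⟩
  · rw [sub_sub_cancel_left]; exact neg_mem hw
  · have : T w - τ i • w = T (q i) - τ i • q i := by simpa using hw'
    rw [map_sub, smul_sub, sub_eq_sub_iff_sub_eq_sub]
    exact this.symm

theorem form_eq_zero_of_mem_span {ι : Type*} {B : V →ₗ[K] V →ₗ[K] K} {s : Set ι} {w : ι → V}
    {x y : V} (hx : x ∈ Submodule.span K (w '' s)) (h : ∀ k ∈ s, B (w k) y = 0) : B x y = 0 := by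
  have : Submodule.span K (w '' s) ≤ LinearMap.ker (B.flip y) := by
    refine Submodule.span_le.2 ?_
    rintro _ ⟨k, hk, rfl⟩
    exact h k hk
  exact this hx

/-- Families `q` and `m` that are dual to each other for a symmetric form which is nondegenerate
on the space that they span. -/
structure DualFamilies {ι : Type*} (B : V →ₗ[K] V →ₗ[K] K) (q m : ι → V) : Prop where
  symm : ∀ x y, B x y = B y x
  dual_self : ∀ i, B (q i) (m i) = 1
  dual_ne : ∀ i j, i ≠ j → B (q i) (m j) = 0
  mem : ∀ i, m i ∈ Submodule.span K (Set.range q)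
  nondeg : ∀ x ∈ Submodule.span K (Set.range q), (∀ j, B (q j) x = 0) → x = 0

/-- `Q` is an orthogonal family which is unitriangular with respect to `q`. -/
structure IsOrthogonalization (B : V →ₗ[K] V →ₗ[K] K) (q Q : ι → V) : Prop where
  triangular : ∀ i, Q i - q i ∈ Submodule.span K (q '' Set.Ioi i)
  ortho : ∀ i j, i ≠ j → B (Q i) (Q j) = 0

theorem exists_isOrthogonalization [Finite ι] {B : V →ₗ[K] V →ₗ[K] K} {q : ι → V}
    {T : V →ₗ[K] V} {τ : ι → K}
    (hT : ∀ i, T (q i) - τ i • q i ∈ Submodule.span K (q '' Set.Ioi i))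
    (hsa : ∀ x y, B (T x) y = B x (T y)) (hτ : Function.Injective τ) :
    ∃ Q, IsOrthogonalization B q Q := by
  choose Q h1 h2 using fun i =>
    exists_eigenvector_of_triangular hT i fun k hk => hτ.ne hk.ne'
  refine ⟨Q, h1, fun i j hij => ?_⟩
  have h3 := hsa (Q i) (Q j)
  rw [h2, h2, map_smul, map_smul, LinearMap.smul_apply, smul_eq_mul, smul_eq_mul,
    ← sub_eq_zero, ← sub_mul] at h3
  exact (mul_eq_zero.1 h3).resolve_left (sub_ne_zero.2 (hτ.ne hij))

variable {B : V →ₗ[K] V →ₗ[K] K} {q m Q : ι → V}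

theorem span_image_le_span_range {ι : Type*} (q : ι → V) (s : Set ι) :
    Submodule.span K (q '' s) ≤ Submodule.span K (Set.range q) :=
  Submodule.span_mono (Set.image_subset_range _ _)

namespace IsOrthogonalization

theorem mem_Ici (hQ : IsOrthogonalization B q Q) (i : ι) :
    Q i ∈ Submodule.span K (q '' Set.Ici i) := by
  have := add_mem (span_Ioi_le_Ici q i (hQ.triangular i)) (self_mem_span_Ici q i)
  rwa [sub_add_cancel] at this

theorem mem_range (hQ : IsOrthogonalization B q Q) (i : ι) :
    Q i ∈ Submodule.span K (Set.range q) :=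
  span_image_le_span_range _ _ (hQ.mem_Ici i)

/-- Inverts the unitriangular change from `q` to `Q`. -/
theorem span_Ici_le [Finite ι] (hQ : IsOrthogonalization B q Q) (i : ι) :
    Submodule.span K (q '' Set.Ici i) ≤ Submodule.span K (Q '' Set.Ici i) := by
  induction i using WellFoundedGT.induction with
  | ind i ih =>
    have h1 : Submodule.span K (q '' Set.Ioi i) ≤ Submodule.span K (Q '' Set.Ici i) := by
      refine Submodule.span_le.2 ?_
      rintro _ ⟨k, hk, rfl⟩
      have hk : i < k := hk
      exact span_Ici_anti Q hk.le (ih k hk (self_mem_span_Ici q k))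
    refine Submodule.span_le.2 ?_
    rintro _ ⟨k, hk, rfl⟩
    rcases eq_or_lt_of_le (Set.mem_Ici.1 hk) with rfl | hk
    · have := sub_mem (self_mem_span_Ici Q i) (h1 (hQ.triangular i))
      rwa [sub_sub_cancel] at this
    · exact h1 (Submodule.subset_span ⟨k, hk, rfl⟩)

theorem form_eq_zero [Finite ι] (hQ : IsOrthogonalization B q Q) {i j : ι} (hij : ¬ i ≤ j)
    {x : V} (hx : x ∈ Submodule.span K (q '' Set.Ici i)) : B x (Q j) = 0 :=
  form_eq_zero_of_mem_span (hQ.span_Ici_le i hx) fun k hk => hQ.ortho k j fun h => hij (h ▸ hk)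

theorem form_q_of_not_le [Finite ι] (hQ : IsOrthogonalization B q Q) {i j : ι}
    (hij : ¬ i ≤ j) : B (q i) (Q j) = 0 :=
  hQ.form_eq_zero hij (self_mem_span_Ici q i)

theorem form_eq_zero_of_mem_Ioi [Finite ι] (hQ : IsOrthogonalization B q Q) {i : ι} {x : V}
    (hx : x ∈ Submodule.span K (q '' Set.Ioi i)) : B x (Q i) = 0 :=
  form_eq_zero_of_mem_span hx fun _ hk => hQ.form_q_of_not_le (not_le_of_gt hk)

theorem form_q_self [Finite ι] (hQ : IsOrthogonalization B q Q) (i : ι) :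
    B (q i) (Q i) = B (Q i) (Q i) := by
  have := hQ.form_eq_zero_of_mem_Ioi (hQ.triangular i)
  rw [map_sub, LinearMap.sub_apply, sub_eq_zero] at this
  exact this.symm

theorem eq_zero [Finite ι] (hd : DualFamilies B q m) (hQ : IsOrthogonalization B q Q) {x : V}
    (hx : x ∈ Submodule.span K (Set.range q)) (h : ∀ j, B (Q j) x = 0) : x = 0 :=
  hd.nondeg x hx fun j =>
    form_eq_zero_of_mem_span (hQ.span_Ici_le j (self_mem_span_Ici q j)) fun k _ => h k

/-- An isotropic `Q i` would be orthogonal to all `Q j`, hence zero, whereas pairing with `m i`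
shows that its `q i` coefficient is 1. -/
theorem form_self_ne_zero [Finite ι] (hd : DualFamilies B q m) (hQ : IsOrthogonalization B q Q)
    (i : ι) : B (Q i) (Q i) ≠ 0 := by
  intro h
  have h0 : Q i = 0 := hQ.eq_zero hd (hQ.mem_range i) fun j => by
    by_cases hj : j = i
    · subst hj; exact h
    · exact hQ.ortho j i hj
  have h1 : B (Q i - q i) (m i) = 0 :=
    form_eq_zero_of_mem_span (hQ.triangular i) fun k hk => hd.dual_ne k i (ne_of_gt hk)
  rw [h0, zero_sub, map_neg, LinearMap.neg_apply, hd.dual_self, neg_eq_zero] at h1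
  exact one_ne_zero h1

/-- A triangular self-adjoint operator is diagonal on the orthogonalization. -/
theorem map_eq_smul [Finite ι] (hd : DualFamilies B q m) (hQ : IsOrthogonalization B q Q)
    {T : V →ₗ[K] V} {τ : ι → K}
    (hT : ∀ i, T (q i) - τ i • q i ∈ Submodule.span K (q '' Set.Ioi i))
    (hsa : ∀ x y, B (T x) y = B x (T y)) (i : ι) : T (Q i) = τ i • Q i := by
  have hq : ∀ j, T (q j) ∈ Submodule.span K (q '' Set.Ici j) := fun j => by
    have := add_mem (span_Ioi_le_Ici q j (hT j))
      (Submodule.smul_mem _ (τ j) (self_mem_span_Ici q j))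
    rwa [sub_add_cancel] at this
  have hle : ∀ j, Submodule.span K (q '' Set.Ici j) ≤
      (Submodule.span K (q '' Set.Ici j)).comap T := fun j => by
    refine Submodule.span_le.2 ?_
    rintro _ ⟨k, hk, rfl⟩
    exact span_Ici_anti q hk (hq k)
  have hTQ : ∀ j, T (Q j) ∈ Submodule.span K (q '' Set.Ici j) := fun j => hle j (hQ.mem_Ici j)
  rw [← sub_eq_zero]
  refine hQ.eq_zero hd (sub_mem (span_image_le_span_range _ _ (hTQ i))
    (Submodule.smul_mem _ _ (hQ.mem_range i))) fun j => ?_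
  rw [hd.symm, map_sub, LinearMap.sub_apply, map_smul, LinearMap.smul_apply]
  by_cases hij : i = j
  · subst hij
    have h1 : T (Q i) - τ i • Q i ∈ Submodule.span K (q '' Set.Ioi i) := by
      have h2 : Submodule.span K (q '' Set.Ioi i) ≤
          (Submodule.span K (q '' Set.Ioi i)).comap T := by
        refine Submodule.span_le.2 ?_
        rintro _ ⟨k, hk, rfl⟩
        exact Submodule.span_mono (Set.image_mono (Set.Ici_subset_Ioi.2 hk)) (hq k)
      have h3 : T (Q i - q i) ∈ Submodule.span K (q '' Set.Ioi i) := h2 (hQ.triangular i)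
      have h4 := sub_mem (add_mem h3 (hT i)) (Submodule.smul_mem _ (τ i) (hQ.triangular i))
      rw [map_sub, smul_sub] at h4
      convert h4 using 1
      abel
    have h4 := hQ.form_eq_zero_of_mem_Ioi h1
    rwa [map_sub, LinearMap.sub_apply, map_smul, LinearMap.smul_apply] at h4
  · rw [hQ.ortho i j hij, smul_zero, sub_zero]
    by_cases h : i ≤ j
    -- Here `i < j`, so `T` is moved to `Q j`: then `T (Q j)` lies above `j`, and `i` does not.
    · rw [hsa, hd.symm]
      exact hQ.form_eq_zero (fun h' => hij (le_antisymm h h')) (hTQ j)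
    · exact hQ.form_eq_zero h (hTQ i)

/-- An eigenvector that is unitriangular with respect to `q` belongs to the orthogonalization. -/
theorem eq_of_eigenvector [Finite ι] (hd : DualFamilies B q m) (hQ : IsOrthogonalization B q Q)
    {T : V →ₗ[K] V} {τ : ι → K}
    (hT : ∀ i, T (q i) - τ i • q i ∈ Submodule.span K (q '' Set.Ioi i))
    (hsa : ∀ x y, B (T x) y = B x (T y)) {i : ι} (hτ : ∀ j, i < j → τ j ≠ τ i) {x : V}
    (hx : x - q i ∈ Submodule.span K (q '' Set.Ioi i)) {c : K} (hc : T x = c • x) :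
    x = Q i := by
  have hx' : x ∈ Submodule.span K (q '' Set.Ici i) := by
    have := add_mem (span_Ioi_le_Ici q i hx) (self_mem_span_Ici q i)
    rwa [sub_add_cancel] at this
  have h1 : ∀ j, (c - τ j) * B x (Q j) = 0 := fun j => by
    have := hsa x (Q j)
    rw [hc, hQ.map_eq_smul hd hT hsa, map_smul, map_smul, LinearMap.smul_apply, smul_eq_mul,
      smul_eq_mul, ← sub_eq_zero, ← sub_mul] at this
    exact this
  have h2 : B x (Q i) = B (Q i) (Q i) := by
    have := hQ.form_eq_zero_of_mem_Ioi hx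
    rwa [map_sub, LinearMap.sub_apply, sub_eq_zero, hQ.form_q_self] at this
  -- The eigenvalue is forced by pairing with `Q i`, since `B x (Q i) = B (Q i) (Q i)` is nonzero.
  have h3 : c = τ i := by
    have := h1 i
    rw [h2] at this
    exact sub_eq_zero.1 ((mul_eq_zero.1 this).resolve_right (hQ.form_self_ne_zero hd i))
  rw [← sub_eq_zero]
  refine hQ.eq_zero hd (sub_mem (span_image_le_span_range _ _ hx') (hQ.mem_range i)) fun j => ?_
  rw [hd.symm, map_sub, LinearMap.sub_apply]
  by_cases hij : i = j
  · subst hij; rw [h2, sub_self]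
  · rw [hQ.ortho i j hij, sub_zero]
    by_cases h : i ≤ j
    · have h4 := h1 j
      rw [h3] at h4
      exact (mul_eq_zero.1 h4).resolve_left
        (sub_ne_zero.2 (hτ j (lt_of_le_of_ne h hij)).symm)
    · exact hQ.form_eq_zero h hx'

/-- The expansion of the rescaled orthogonalization in the dual family. -/
theorem inv_smul_sub_mem [Finite ι] (hd : DualFamilies B q m) (hQ : IsOrthogonalization B q Q)
    (i : ι) : (B (Q i) (Q i))⁻¹ • Q i - m i ∈ Submodule.span K (m '' Set.Iio i) := by
  classical
  have := Fintype.ofFinite ι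
  set P := (B (Q i) (Q i))⁻¹ • Q i with hP
  have hqP : ∀ j, B (q j) P = if j = i then 1 else if j < i then B (q j) P else 0 := by
    intro j
    split_ifs with h1 h2
    · subst h1
      rw [hP, map_smul, smul_eq_mul, hQ.form_q_self,
        inv_mul_cancel₀ (hQ.form_self_ne_zero hd j)]
    · rfl
    · rw [hP, map_smul, hQ.form_q_of_not_le, smul_zero]
      exact fun h => h2 (lt_of_le_of_ne h h1)
  -- By duality the coefficient of `m j` in `P` is `B (q j) P`, which is 1 at `i` and vanishes for
  -- the remaining `j` not below `i`.
  have hsum : P - m i = ∑ j ∈ Finset.univ.filter (· < i), B (q j) P • m j := by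
    rw [← sub_eq_zero]
    refine hd.nondeg _ ?_ fun k => ?_
    · exact sub_mem (sub_mem (Submodule.smul_mem _ _ (hQ.mem_range i)) (hd.mem i))
        (Submodule.sum_mem _ fun j _ => Submodule.smul_mem _ _ (hd.mem j))
    · have h1 : ∀ j, B (q k) (B (q j) P • m j) = if j = k then B (q k) P else 0 := fun j => by
        split_ifs with h
        · subst h; rw [map_smul, hd.dual_self, smul_eq_mul, mul_one]
        · rw [map_smul, hd.dual_ne k j (Ne.symm h), smul_zero]
      rw [map_sub, map_sub, map_sum]
      simp only [h1, Finset.sum_ite_eq', Finset.mem_filter, Finset.mem_univ, true_and]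
      rw [hqP]
      by_cases hk : k = i
      · subst hk; simp [hd.dual_self]
      · rw [if_neg hk, hd.dual_ne k i hk]; split_ifs <;> simp
  rw [hsum]
  exact Submodule.sum_mem _ fun j hj => Submodule.smul_mem _ _
    (Submodule.subset_span ⟨j, (Finset.mem_filter.1 hj).2, rfl⟩)

/-- An orthogonal family that is unitriangular with respect to the dual family is the rescaled
orthogonalization. -/
theorem eq_inv_smul [Finite ι] (hd : DualFamilies B q m) (hQ : IsOrthogonalization B q Q)
    {P : ι → V} (hP : ∀ i, P i - m i ∈ Submodule.span K (m '' Set.Iio i))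
    (hort : ∀ i j, i ≠ j → B (P i) (P j) = 0) (i : ι) : P i = (B (Q i) (Q i))⁻¹ • Q i := by
  induction i using WellFoundedLT.induction with
  | ind i ih =>
    have hmem : Submodule.span K (m '' Set.Iio i) ≤ Submodule.span K (Set.range q) := by
      refine Submodule.span_le.2 ?_
      rintro _ ⟨k, _, rfl⟩
      exact hd.mem k
    have h1 : P i - (B (Q i) (Q i))⁻¹ • Q i ∈ Submodule.span K (m '' Set.Iio i) := by
      have := sub_mem (hP i) (hQ.inv_smul_sub_mem hd i)
      rwa [sub_sub_sub_cancel_right] at this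
    rw [← sub_eq_zero]
    refine hQ.eq_zero hd (hmem h1) fun j => ?_
    rw [hd.symm]
    by_cases hj : j < i
    -- Below `i` the induction hypothesis turns orthogonality to `P j` into orthogonality to `Q j`;
    -- for other `j`, duality of `q` and `m` suffices.
    · have h2 : Q j = B (Q j) (Q j) • P j := by
        rw [ih j hj, smul_smul, mul_inv_cancel₀ (hQ.form_self_ne_zero hd j), one_smul]
      rw [map_sub, LinearMap.sub_apply, map_smul, LinearMap.smul_apply, hQ.ortho i j hj.ne',
        smul_zero, sub_zero, h2, map_smul, hort i j hj.ne', smul_zero]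
    · refine form_eq_zero_of_mem_span h1 fun k hk => ?_
      rw [hd.symm]
      refine form_eq_zero_of_mem_span (hQ.mem_Ici j) fun l hl => hd.dual_ne l k ?_
      rintro rfl
      exact hj (lt_of_le_of_lt hl hk)

end IsOrthogonalization

end Orthogonalization

end Jack

namespace Jack

open MvPolynomial

/-! ### Pairing with the `q_μ` extracts coefficients -/

/-- The product of the `q_{d_i}`. -/
noncomputable def qMono (d : ℕ →₀ ℕ) : Sym := d.prod fun _ n => qRow n

theorem qMono_eq_qProd (d : ℕ →₀ ℕ) : qMono d = qProd (d.support.val.map d) := by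
  rw [qProd, Multiset.map_map]; rfl

theorem qRow_mul_qMono_erase (d : ℕ →₀ ℕ) (i : ℕ) : qRow (d i) * qMono (d.erase i) = qMono d :=
  Finsupp.mul_prod_erase' d i (fun _ n => qRow n) fun _ => qRow_zero

theorem grad_qMono (d : ℕ →₀ ℕ) :
    grad (qMono d) = ∑ i ∈ d.support, rowV (d i) * Polynomial.C (qMono (d.erase i)) := by
  rw [qMono_eq_qProd, grad_qProd, Multiset.map_map]
  refine Finset.sum_congr rfl fun i hi => ?_
  rw [Function.comp_apply, qMono_eq_qProd, Finsupp.support_erase, Finset.erase_val,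
    ← Multiset.map_erase_of_mem _ _ (show i ∈ d.support.val from hi)]
  congr 3
  refine Multiset.map_congr rfl fun j hj => ?_
  rw [Finsupp.erase_ne]
  rw [← Finset.erase_val] at hj
  exact Finset.ne_of_mem_erase hj

theorem erase_sub_single (d : ℕ →₀ ℕ) (i l : ℕ) :
    (d - Finsupp.single i l).erase i = d.erase i := by
  ext j
  by_cases h : j = i
  · simp [h]
  · simp [Finsupp.erase_ne h, h]

theorem coeff_grad_qMono (d : ℕ →₀ ℕ) (l : ℕ+) :
    (grad (qMono d)).coeff l =
      ∑ i ∈ d.support with (l : ℕ) ≤ d i, qMono (d - Finsupp.single i (l : ℕ)) := by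
  rw [grad_qMono, Polynomial.finsetSum_coeff, Finset.sum_filter]
  refine Finset.sum_congr rfl fun i _ => ?_
  rw [Polynomial.coeff_mul_C, coeff_rowV]
  by_cases h : (l : ℕ) ≤ d i
  · rw [if_pos ⟨l.pos, h⟩, if_pos h, ← qRow_mul_qMono_erase (d - _) i, erase_sub_single]
    simp
  · rw [if_neg fun hc => h hc.2, if_neg h, zero_mul]

theorem coeff_powerSumSeries (l : ℕ+) (d : ℕ →₀ ℕ) [Decidable (∃ i, d = Finsupp.single i (l : ℕ))] :
    MvPowerSeries.coeff d (powerSumSeries l) =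
      if ∃ i : ℕ, d = Finsupp.single i (l : ℕ) then 1 else 0 := by
  rw [MvPowerSeries.coeff_apply, powerSumSeries]
  congr

/-- The same recursion in `d` as in `coeff_grad_qMono`, so pairing with `q_d` and taking the
coefficient of `x ^ d` agree by induction on `f`. -/
theorem coeff_mul_powerSumSeries (d : ℕ →₀ ℕ) (l : ℕ+) (g : MvPowerSeries ℕ F) :
    MvPowerSeries.coeff d (g * powerSumSeries l) = ∑ i ∈ d.support with (l : ℕ) ≤ d i,
      MvPowerSeries.coeff (d - Finsupp.single i (l : ℕ)) g := by
  classical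
  rw [MvPowerSeries.coeff_mul]
  simp only [coeff_powerSumSeries, mul_ite, mul_one, mul_zero]
  rw [← Finset.sum_filter]
  symm
  refine Finset.sum_bij
    (fun i _ => (d - Finsupp.single i (l : ℕ), Finsupp.single i (l : ℕ))) ?_ ?_ ?_ ?_
  · intro i hi
    obtain ⟨_, hi⟩ := Finset.mem_filter.1 hi
    simp only [Finset.mem_filter, Finset.HasAntidiagonal.mem_antidiagonal]
    exact ⟨tsub_add_cancel_of_le (Finsupp.single_le_iff.2 hi), i, rfl⟩
  · intro i _ j _ h
    exact (Finsupp.single_left_inj l.ne_zero).1 (Prod.ext_iff.1 h).2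
  · rintro ⟨u, v⟩ h
    simp only [Finset.mem_filter, Finset.HasAntidiagonal.mem_antidiagonal] at h
    obtain ⟨rfl, i, rfl⟩ := h
    refine ⟨i, Finset.mem_filter.2 ⟨Finsupp.mem_support_iff.2 ?_, ?_⟩, by simp⟩
    · simp
    · simp
  · intro i _
    rfl

theorem coeff_zero_qRow (n : ℕ) : coeff 0 (qRow n) = if n = 0 then 1 else 0 := by
  have h := form_qRow_monomial n 0
  rw [form_monomial_right] at h
  simp only [wt, weightNorm, Finsupp.sum_zero_index, Finsupp.prod_zero_index, pow_zero,
    mul_one] at h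
  rw [h]
  exact if_congr eq_comm rfl rfl

theorem coeff_zero_qMono (d : ℕ →₀ ℕ) : coeff 0 (qMono d) = if d = 0 then 1 else 0 := by
  rw [← constantCoeff_eq, qMono, Finsupp.prod, map_prod]
  split_ifs with h
  · subst h; simp
  · obtain ⟨i, hi⟩ := Finsupp.support_nonempty_iff.2 h
    refine Finset.prod_eq_zero hi ?_
    rw [constantCoeff_eq, coeff_zero_qRow, if_neg (Finsupp.mem_support_iff.1 hi)]

/-- Pairing with `q_d` extracts the coefficient of `x ^ d`. -/
theorem form_qMono (f : Sym) (d : ℕ →₀ ℕ) :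
    form (qMono d) f = MvPowerSeries.coeff d (toSeries f) := by
  classical
  induction f using MvPolynomial.induction_on generalizing d with
  | C a =>
    have h1 : (C a : Sym) = a • monomial 0 1 := by
      rw [smul_monomial]; simp
    have h2 : toSeries (C a) = MvPowerSeries.C a := by
      rw [toSeries, ← MvPolynomial.algebraMap_eq, AlgHom.commutes]; rfl
    rw [h2, MvPowerSeries.coeff_C, h1, map_smul, form_monomial_right, coeff_zero_qMono]
    simp [weightNorm]
  | add f g hf hg => rw [map_add, map_add, map_add, hf, hg]
  | mul_X f l hf =>
    have h1 : toSeries (X l) = powerSumSeries l := aeval_X _ _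
    rw [map_mul toSeries, h1, coeff_mul_powerSumSeries, form_comm, mul_comm, form_X_mul,
      ← coeff_grad_pnat, coeff_grad_qMono, map_sum]
    exact Finset.sum_congr rfl fun i _ => by rw [form_comm, hf]

theorem prod_range_getD (l : List ℕ) (f : ℕ → Sym) :
    ∏ i ∈ Finset.range l.length, f (l.getD i 0) = (l.map f).prod := by
  induction l with
  | nil => simp
  | cons a l ih =>
    rw [List.length_cons, Finset.prod_range_succ', List.map_cons, List.prod_cons, ← ih, mul_comm]
    simp

theorem exists_qMono_eq {n : ℕ} (μ : n.Partition) : ∃ d, q μ = qMono d := by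
  refine ⟨μ.parts.toList.toFinsupp, ?_⟩
  rw [qMono, Finsupp.prod_of_support_subset (s := Finset.range μ.parts.toList.length)]
  · simp only [List.toFinsupp_apply]
    rw [prod_range_getD, q, ← Multiset.prod_coe, ← Multiset.map_coe, Multiset.coe_toList]
  · exact Finset.filter_subset _ _
  · intro i _
    exact qRow_zero

/-! ### The `q_μ` span the ring of symmetric functions -/

theorem rowV_eq_sum (n : ℕ) :
    rowV n = ∑ k ∈ Finset.range n, Polynomial.monomial (k + 1) (qRow (n - (k + 1))) := by
  ext1 m
  rw [coeff_rowV, Polynomial.finsetSum_coeff]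
  simp only [Polynomial.coeff_monomial]
  cases m with
  | zero => simp
  | succ m =>
    simp only [Nat.add_right_cancel_iff, Finset.sum_ite_eq', Finset.mem_range]
    exact if_congr (by omega) rfl rfl

/-- Newton's identity. -/
theorem sum_pw_mul_qRow (n : ℕ) :
    ∑ k ∈ Finset.range n, pw (k + 1) * qRow (n - (k + 1)) = (α * (n : F)) • qRow n := by
  rw [← gradAdj_rowV, rowV_eq_sum, map_sum]
  exact Finset.sum_congr rfl fun k _ => by rw [gradAdj_monomial, if_neg (by omega)]

/-- In Newton's identity the last power sum has coefficient `q_0 = 1`, so it can be solved for. -/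
theorem pw_mem_adjoin (n : ℕ) : pw (n + 1) ∈ Algebra.adjoin F (Set.range qRow) := by
  induction n using Nat.strong_induction_on with
  | _ n ih =>
    have hq : ∀ k, qRow k ∈ Algebra.adjoin F (Set.range qRow) :=
      fun k => Algebra.subset_adjoin ⟨k, rfl⟩
    have h := sum_pw_mul_qRow (n + 1)
    rw [Finset.sum_range_succ, Nat.sub_self, qRow_zero, mul_one, ← eq_sub_iff_add_eq'] at h
    rw [h]
    refine sub_mem (Subalgebra.smul_mem _ (hq _) _) (sum_mem fun k hk => mul_mem ?_ (hq _))
    exact ih k (Finset.mem_range.1 hk)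

theorem adjoin_qRow : Algebra.adjoin F (Set.range qRow) = ⊤ := by
  rw [eq_top_iff, ← adjoin_range_X]
  refine Algebra.adjoin_le ?_
  rintro _ ⟨l, rfl⟩
  have := pw_mem_adjoin l.natPred
  rw [PNat.natPred_add_one, pw_coe] at this
  exact this

theorem span_q : Submodule.span F (Set.range fun μ : Ptn => q μ.2) = ⊤ := by
  have h := Algebra.adjoin_eq_span F (Set.range qRow)
  rw [adjoin_qRow, Algebra.top_toSubmodule] at h
  rw [eq_top_iff, h]
  refine Submodule.span_mono fun x hx => ?_
  obtain ⟨s, rfl⟩ : ∃ s, qProd s = x := by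
    induction hx using Submonoid.closure_induction with
    | mem x hx =>
      obtain ⟨n, rfl⟩ := hx
      exact ⟨{n}, by simp [qProd]⟩
    | one => exact ⟨0, by simp [qProd]⟩
    | mul x y _ _ hx hy =>
      obtain ⟨s, rfl⟩ := hx
      obtain ⟨t, rfl⟩ := hy
      exact ⟨s + t, by simp [qProd]⟩
  exact ⟨⟨s.sum, Nat.Partition.ofSums _ s rfl⟩, q_ofSums _ s rfl⟩

theorem eq_zero_of_form_q {f : Sym} (h : ∀ μ : Ptn, form (q μ.2) f = 0) : f = 0 := by
  refine eq_zero_of_form fun g => ?_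
  have hg : g ∈ Submodule.span F (Set.range fun μ : Ptn => q μ.2) := by
    rw [span_q]; exact Submodule.mem_top
  rw [← Set.image_univ] at hg
  exact form_eq_zero_of_mem_span hg fun μ _ => h μ

/-- The coefficients of the series are pairings with the `q_μ`, which span, and the form is
nondegenerate. -/
theorem toSeries_injective : Function.Injective toSeries := by
  refine (injective_iff_map_eq_zero toSeries).2 fun f hf => eq_zero_of_form_q fun μ => ?_
  obtain ⟨d, hd⟩ := exists_qMono_eq μ.2
  rw [hd, form_qMono, hf, map_zero]

/-! ### Homogeneous components -/

/-- The degree of a power sum. -/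
def pDeg (i : ℕ+) : ℕ := i

theorem weight_eq_wt (d : ℕ+ →₀ ℕ) : Finsupp.weight pDeg d = wt d := by
  rw [Finsupp.weight_apply]; rfl

theorem isWeightedHomogeneous_qRow (n : ℕ) : IsWeightedHomogeneous pDeg (qRow n) n := by
  intro d hd
  have h := form_qRow_monomial n d
  rw [form_monomial_right] at h
  rw [weight_eq_wt]
  by_contra hc
  rw [if_neg hc] at h
  exact mul_ne_zero hd (weightNorm_ne_zero d) h

theorem isWeightedHomogeneous_qProd (s : Multiset ℕ) :
    IsWeightedHomogeneous pDeg (qProd s) s.sum := by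
  induction s using Multiset.induction_on with
  | empty => simpa [qProd] using isWeightedHomogeneous_one F pDeg
  | cons a s ih =>
    rw [qProd_cons, Multiset.sum_cons]
    exact (isWeightedHomogeneous_qRow a).mul ih

theorem isWeightedHomogeneous_q {n : ℕ} (μ : n.Partition) :
    IsWeightedHomogeneous pDeg (q μ) n := by
  have := isWeightedHomogeneous_qProd μ.parts
  rwa [μ.parts_sum] at this

theorem form_eq_zero_of_ne {m n : ℕ} (hmn : m ≠ n) {f g : Sym}
    (hf : IsWeightedHomogeneous pDeg f m) (hg : IsWeightedHomogeneous pDeg g n) :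
    form f g = 0 := by
  rw [form_apply, scalar_eq_sum f g _ subset_rfl]
  refine Finset.sum_eq_zero fun d hd => ?_
  by_cases h : coeff d g = 0
  · rw [h, mul_zero, zero_mul]
  · exact absurd ((hf (mem_support_iff.1 hd)).symm.trans (hg h)) hmn

/-- The span of the `q_μ` with `μ` a partition of `n`. -/
noncomputable def qSpan (n : ℕ) : Submodule F Sym :=
  Submodule.span F (Set.range (q : n.Partition → Sym))

theorem isWeightedHomogeneous_of_mem_qSpan {n : ℕ} {f : Sym} (hf : f ∈ qSpan n) :
    IsWeightedHomogeneous pDeg f n := by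
  have : qSpan n ≤ weightedHomogeneousSubmodule F pDeg n := by
    refine Submodule.span_le.2 ?_
    rintro _ ⟨μ, rfl⟩
    exact isWeightedHomogeneous_q μ
  exact this hf

/-- Projecting an expansion in all `q_μ` to degree `n` kills those of other degrees. -/
theorem mem_qSpan {n : ℕ} {f : Sym} (hf : IsWeightedHomogeneous pDeg f n) : f ∈ qSpan n := by
  classical
  have hf' : f ∈ Submodule.span F (Set.range fun μ : Ptn => q μ.2) := by
    rw [span_q]; exact Submodule.mem_top
  have h1 : Submodule.span F (Set.range fun μ : Ptn => q μ.2) ≤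
      (qSpan n).comap (weightedHomogeneousComponent pDeg n) := by
    refine Submodule.span_le.2 ?_
    rintro _ ⟨⟨m, μ⟩, rfl⟩
    rw [SetLike.mem_coe, Submodule.mem_comap]
    by_cases h : m = n
    · subst h
      have : weightedHomogeneousComponent pDeg m (q μ) = q μ :=
        (isWeightedHomogeneous_q μ).weightedHomogeneousComponent_same
      rw [this]
      exact Submodule.subset_span ⟨μ, rfl⟩
    · have : weightedHomogeneousComponent pDeg n (q μ) = 0 :=
        (isWeightedHomogeneous_q μ).weightedHomogeneousComponent_ne _ (Ne.symm h)
      rw [this]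
      exact zero_mem _
  have h2 := h1 hf'
  rwa [Submodule.mem_comap, hf.weightedHomogeneousComponent_same] at h2

theorem powerSum_mem_qSpan {n : ℕ} (μ : n.Partition) : powerSum μ ∈ qSpan n := by
  refine mem_qSpan ?_
  rw [powerSum_eq_monomial]
  refine isWeightedHomogeneous_monomial _ _ _ ?_
  rw [Finsupp.weight_apply]
  refine Eq.trans ?_ μ.parts_sum
  conv_rhs => rw [← parts_eq μ]
  generalize μ.parts.map Nat.toPNat' = s
  rw [Finsupp.sum, Multiset.toFinsupp_support]
  simp only [Multiset.toFinsupp_apply, pDeg]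
  exact (Finset.sum_multiset_map_count s fun i : ℕ+ => (i : ℕ)).symm

theorem eq_zero_of_mem_qSpan {n : ℕ} {f : Sym} (hf : f ∈ qSpan n)
    (h : ∀ μ : n.Partition, form (q μ) f = 0) : f = 0 := by
  refine eq_zero_of_form_q fun ⟨m, μ⟩ => ?_
  by_cases hm : m = n
  · subst hm; exact h μ
  · exact form_eq_zero_of_ne hm (isWeightedHomogeneous_q μ) (isWeightedHomogeneous_of_mem_qSpan hf)

instance (n : ℕ) : FiniteDimensional F (qSpan n) :=
  FiniteDimensional.span_of_finite F (Set.finite_range _)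

theorem linearIndependent_powerSum (n : ℕ) :
    LinearIndependent F (powerSum : n.Partition → Sym) := by
  have h := (basisMonomials ℕ+ F).linearIndependent.comp
    (fun μ : n.Partition => Multiset.toFinsupp (μ.parts.map Nat.toPNat')) fun μ ν h => by
      have h1 := congrArg (Multiset.map (fun i : ℕ+ => (i : ℕ))) (Multiset.toFinsupp.injective h)
      rw [parts_eq, parts_eq] at h1
      exact Nat.Partition.ext h1
  have h2 : (powerSum : n.Partition → Sym) = basisMonomials ℕ+ F ∘
      fun μ : n.Partition => Multiset.toFinsupp (μ.parts.map Nat.toPNat') := by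
    ext1 μ
    rw [powerSum_eq_monomial, Function.comp_apply, coe_basisMonomials]
  rw [h2]
  exact h

theorem finrank_qSpan (n : ℕ) : Module.finrank F (qSpan n) = Fintype.card n.Partition := by
  refine le_antisymm (finrank_range_le_card _) ?_
  rw [← finrank_span_eq_card (linearIndependent_powerSum n)]
  refine Submodule.finrank_mono (Submodule.span_le.2 ?_)
  rintro _ ⟨μ, rfl⟩
  exact powerSum_mem_qSpan μ

/-- Pairing with all `q_μ` is injective on `qSpan n`, whose dimension is the number of partitions,
so it is bijective and coordinate vectors lift. -/
theorem exists_dual (n : ℕ) : ∃ m : n.Partition → Sym, ∀ ν, m ν ∈ qSpan n ∧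
    form (q ν) (m ν) = 1 ∧ ∀ μ, μ ≠ ν → form (q μ) (m ν) = 0 := by
  classical
  let φ : qSpan n →ₗ[F] (n.Partition → F) :=
    LinearMap.pi fun μ => form (q μ) ∘ₗ (qSpan n).subtype
  have hinj : Function.Injective φ := by
    refine (injective_iff_map_eq_zero φ).2 fun f hf => ?_
    exact Subtype.ext (eq_zero_of_mem_qSpan f.2 fun μ => congrFun hf μ)
  have hsurj : Function.Surjective φ := by
    refine (LinearMap.injective_iff_surjective_of_finrank_eq_finrank ?_).1 hinj
    rw [finrank_qSpan, Module.finrank_fintype_fun_eq_card]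
  choose g hg using fun ν : n.Partition => hsurj (Pi.single ν 1)
  have hg' : ∀ μ ν, form (q μ) (g ν) = (Pi.single ν 1 : n.Partition → F) μ :=
    fun μ ν => congrFun (hg ν) μ
  exact ⟨fun ν => g ν, fun ν => ⟨(g ν).2, by rw [hg', Pi.single_eq_same],
    fun μ h => by rw [hg', Pi.single_eq_of_ne h]⟩⟩

/-- The monomial symmetric functions as elements of the polynomial ring in the power sums. -/
noncomputable def mono {n : ℕ} : n.Partition → Sym := Classical.choose (exists_dual n)

theorem mono_spec {n : ℕ} (ν : n.Partition) : mono ν ∈ qSpan n ∧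
    form (q ν) (mono ν) = 1 ∧ ∀ μ, μ ≠ ν → form (q μ) (mono ν) = 0 :=
  Classical.choose_spec (exists_dual n) ν

theorem dualFamilies (n : ℕ) : DualFamilies form (q : n.Partition → Sym) mono where
  symm := form_comm
  dual_self i := (mono_spec i).2.1
  dual_ne i j h := (mono_spec j).2.2 i h
  mem i := (mono_spec i).1
  nondeg _ hx h := eq_zero_of_mem_qSpan hx h

/-- The coefficient of `x ^ d` is the pairing with `q_d`: a Kronecker delta in degree `n` by
duality, and zero in other degrees. -/
theorem toSeries_mono {n : ℕ} (μ : n.Partition) : toSeries (mono μ) = monomialSymm μ := by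
  classical
  ext d
  rw [← form_qMono, qMono_eq_qProd, MvPowerSeries.coeff_apply, monomialSymm]
  by_cases h : (d.support.val.map d).sum = n
  · obtain ⟨ν, hp, hq⟩ : ∃ ν : n.Partition, ν.parts = d.support.val.map d ∧
        q ν = qProd (d.support.val.map d) := by
      refine ⟨_, ?_, q_ofSums n _ h⟩
      rw [Nat.Partition.ofSums_parts, Multiset.filter_eq_self]
      intro a ha
      obtain ⟨i, hi, rfl⟩ := Multiset.mem_map.1 ha
      exact Finsupp.mem_support_iff.1 hi
    rw [← hp, ← q_eq_qProd]
    by_cases hν : ν = μ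
    · subst hν; rw [(mono_spec ν).2.1]; simp
    · rw [(mono_spec μ).2.2 ν hν, if_neg fun hc => hν (Nat.Partition.ext hc)]
  · have h1 : d.support.val.map d ≠ μ.parts := fun hc => h (by rw [hc, μ.parts_sum])
    rw [if_neg h1]
    exact form_eq_zero_of_ne h (isWeightedHomogeneous_qProd _)
      (isWeightedHomogeneous_of_mem_qSpan (mono_spec μ).1)

end Jack

namespace Jack

/-! ### An operator with simple spectrum -/

theorem digits_unique {b : ℕ} (N : ℕ) (f g : ℕ → ℕ) (hf : ∀ i, f i < b) (hg : ∀ i, g i < b)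
    (h : ∑ i ∈ Finset.range N, f i * b ^ i = ∑ i ∈ Finset.range N, g i * b ^ i) :
    ∀ i < N, f i = g i := by
  induction N generalizing f g with
  | zero => intro i hi; omega
  | succ N ih =>
    have hs : ∀ f : ℕ → ℕ, ∑ i ∈ Finset.range (N + 1), f i * b ^ i =
        f 0 + b * ∑ i ∈ Finset.range N, f (i + 1) * b ^ i := fun f => by
      rw [Finset.sum_range_succ', pow_zero, mul_one, add_comm, Finset.mul_sum]
      congr 1
      exact Finset.sum_congr rfl fun i _ => by ring
    rw [hs, hs] at h
    have h0 : f 0 = g 0 := by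
      have := congrArg (· % b) h
      simpa [Nat.add_mul_mod_self_left, Nat.mod_eq_of_lt (hf 0), Nat.mod_eq_of_lt (hg 0)]
        using this
    have hb : 0 < b := (Nat.zero_le _).trans_lt (hf 0)
    rw [h0] at h
    have h1 := Nat.eq_of_mul_eq_mul_left hb (Nat.add_left_cancel h)
    intro i hi
    cases i with
    | zero => exact h0
    | succ i =>
      exact ih (fun i => f (i + 1)) (fun i => g (i + 1)) (fun _ => hf _) (fun _ => hg _) h1 i
        (by omega)

theorem count_mul_le {n : ℕ} (ν : n.Partition) (i : ℕ) : ν.parts.count i * i ≤ n := by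
  have h := Multiset.le_count_iff_replicate_le.1 (le_refl (ν.parts.count i))
  obtain ⟨u, hu⟩ := Multiset.le_iff_exists_add.1 h
  have h2 := congrArg Multiset.sum hu
  rw [ν.parts_sum, Multiset.sum_add, Multiset.sum_replicate, smul_eq_mul] at h2
  omega

theorem le_of_mem_parts {n : ℕ} (ν : n.Partition) {i : ℕ} (hi : i ∈ ν.parts) : i ≤ n := by
  rw [← ν.parts_sum]
  exact Multiset.single_le_sum (fun _ _ => Nat.zero_le _) i hi

/-- This number written in base `n + 1` has `i`-th digit `i` times the multiplicity of `i`, which is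
at most `n`. -/
theorem sum_mul_pow_injective (n : ℕ) : Function.Injective fun ν : n.Partition =>
    (ν.parts.map fun i => i * (n + 1) ^ i).sum := by
  have hs : ∀ ν : n.Partition, (ν.parts.map fun i => i * (n + 1) ^ i).sum =
      ∑ i ∈ Finset.range (n + 1), ν.parts.count i * i * (n + 1) ^ i := by
    intro ν
    rw [Finset.sum_multiset_map_count]
    simp only [smul_eq_mul, ← mul_assoc]
    refine Finset.sum_subset (fun i hi => ?_) fun i _ hi => ?_
    · have := le_of_mem_parts ν (Multiset.mem_toFinset.1 hi)
      rw [Finset.mem_range]; omega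
    · rw [Multiset.count_eq_zero_of_notMem (by simpa using hi), zero_mul, zero_mul]
  intro μ ν h
  simp only [hs] at h
  have h1 := digits_unique (n + 1) (fun i => μ.parts.count i * i) (fun i => ν.parts.count i * i)
    (fun i => Nat.lt_succ_of_le (count_mul_le μ i)) (fun i => Nat.lt_succ_of_le (count_mul_le ν i))
    h
  -- This injection records exactly the digits: `i` is sent to its multiplicity times `i`.
  refine Nat.Partition.toFinsuppAntidiag_injective n (Finsupp.ext fun i => ?_)
  by_cases hi : i < n + 1
  · exact h1 i hi
  · have h2 : ∀ κ : n.Partition, κ.parts.count i = 0 := fun κ =>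
      Multiset.count_eq_zero_of_notMem fun hc => hi (Nat.lt_succ_of_le (le_of_mem_parts κ hc))
    change μ.parts.count i * i = ν.parts.count i * i
    rw [h2, h2]

/-- Expresses the separating quantity `∑ ν_i (n+1)^(ν_i)` through the power sums of the parts of
exponents 1 to `n`, the leading coefficients of the `ham j`. -/
theorem exists_interpolation (n : ℕ) : ∃ c : ℕ → ℚ, ∀ i, 1 ≤ i → i ≤ n →
    ∑ j ∈ Finset.range n, c j * (i : ℚ) ^ j = ((n + 1 : ℕ) : ℚ) ^ i := by
  have hinj : Set.InjOn (fun i : ℕ => (i : ℚ)) (Finset.Icc 1 n : Finset ℕ) :=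
    fun i _ j _ h => Nat.cast_injective h
  let p := Lagrange.interpolate (Finset.Icc 1 n) (fun i : ℕ => (i : ℚ))
    fun i => ((n + 1 : ℕ) : ℚ) ^ i
  refine ⟨p.coeff, fun i h1 h2 => ?_⟩
  have hdeg : p.degree < n := by
    have := Lagrange.degree_interpolate_lt (fun i => ((n + 1 : ℕ) : ℚ) ^ i) hinj
    rwa [Nat.card_Icc, Nat.add_sub_cancel] at this
  have hev := Lagrange.eval_interpolate_at_node (fun i => ((n + 1 : ℕ) : ℚ) ^ i) hinj
    (Finset.mem_Icc.2 ⟨h1, h2⟩)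
  rw [← hev]
  change _ = p.eval (i : ℚ)
  by_cases h0 : p = 0
  · simp [h0]
  · rw [Polynomial.eval_eq_sum_range' ((Polynomial.natDegree_lt_iff_degree_lt h0).2 hdeg)]

theorem sum_mul_partPow {n : ℕ} {c : ℕ → ℚ} (hc : ∀ i, 1 ≤ i → i ≤ n →
    ∑ j ∈ Finset.range n, c j * (i : ℚ) ^ j = ((n + 1 : ℕ) : ℚ) ^ i) (ν : n.Partition) :
    ∑ j ∈ Finset.range n, c j * (partPow ν (j + 1) : ℚ) =
      ((ν.parts.map fun i => i * (n + 1) ^ i).sum : ℕ) := by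
  have hcast : ∀ f : ℕ → ℕ, ((ν.parts.map f).sum : ℚ) = (ν.parts.map fun i => (f i : ℚ)).sum :=
    fun f => map_multiset_sum_map (Nat.castAddMonoidHom ℚ) ν.parts f
  simp only [partPow, hcast, ← Multiset.sum_map_mul_left]
  rw [← Multiset.sum_map_sum]
  refine congrArg Multiset.sum (Multiset.map_congr rfl fun i hi => ?_)
  rw [Nat.cast_mul, Nat.cast_pow, ← hc i (ν.parts_pos hi) (le_of_mem_parts ν hi), Finset.mul_sum]
  exact Finset.sum_congr rfl fun j _ => by push_cast; ring

theorem exists_separating_operator (n : ℕ) :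
    ∃ (T : Sym →ₗ[F] Sym) (τ : n.Partition → F), (∀ ν, T (q ν) - τ ν • q ν ∈ qAbove ν) ∧
      (∀ f g, form (T f) g = form f (T g)) ∧ Function.Injective τ := by
  obtain ⟨c, hc⟩ := exists_interpolation n
  choose a ha hmem using fun j => fun ν : n.Partition => ham_q_sub_mem j ν
  -- The power `α ^ (n - j)` brings all leading terms to the common degree `n + 1`, so the unknown
  -- `a j ν` cannot interfere with them.
  let k : ℕ → F := fun j => α ^ (n - j) * algebraMap ℚ F (c j)
  let τ : n.Partition → F := fun ν => ∑ j ∈ Finset.range n,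
    k j * (α ^ (j + 1) * (partPow ν (j + 1) : F) + α * a j ν)
  refine ⟨∑ j ∈ Finset.range n, k j • ham j, τ, fun ν => ?_, fun f g => ?_, ?_⟩
  · rw [LinearMap.sum_apply, Finset.sum_smul, ← Finset.sum_sub_distrib]
    refine Submodule.sum_mem _ fun j _ => ?_
    rw [LinearMap.smul_apply, mul_smul (k j), ← smul_sub]
    exact Submodule.smul_mem _ _ (hmem j ν)
  · simp only [LinearMap.sum_apply, map_sum, LinearMap.smul_apply, map_smul, form_ham]
  · have hb : ∀ ν, ∃ b ∈ degLT n, τ ν = α * (α ^ n * algebraMap ℚ F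
        (((ν.parts.map fun i => i * (n + 1) ^ i).sum : ℕ) : ℚ) + b) := by
      intro ν
      refine ⟨∑ j ∈ Finset.range n, k j * a j ν, Submodule.sum_mem _ fun j hj => ?_, ?_⟩
      · have hj := Finset.mem_range.1 hj
        have h1 := α_pow_mul_mem_degLT (ha j ν) (n - j)
        rw [Nat.add_sub_cancel' hj.le] at h1
        rw [show k j * a j ν = algebraMap ℚ F (c j) * (α ^ (n - j) * a j ν) by
          simp only [k]; ring, ← Algebra.smul_def]
        exact Submodule.smul_mem _ _ h1
      · rw [← sum_mul_partPow hc, map_sum, Finset.mul_sum, ← Finset.sum_add_distrib,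
          Finset.mul_sum]
        refine Finset.sum_congr rfl fun j hj => ?_
        have hj := Finset.mem_range.1 hj
        have h1 : α ^ n = α ^ (n - j) * α ^ j := by rw [← pow_add, Nat.sub_add_cancel hj.le]
        rw [map_mul, map_natCast, h1]
        simp only [k]
        ring
    intro μ ν h
    obtain ⟨b, hb1, hb2⟩ := hb μ
    obtain ⟨b', hb1', hb2'⟩ := hb ν
    rw [hb2, hb2'] at h
    have h1 := mul_left_cancel₀ α_ne_zero h
    refine sum_mul_pow_injective n (Nat.cast_injective (R := ℚ) (sub_eq_zero.1 ?_))
    apply eq_zero_of_α_pow_mul_mem (d := n)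
    have h2 := sub_mem hb1' hb1
    convert h2 using 1
    rw [map_sub]
    linear_combination h1

/-! ### The Jack functions -/

theorem span_Ioi_eq {n : ℕ} (ν : n.Partition) (w : n.Partition → Sym) :
    Submodule.span F (w '' Set.Ioi ν) = Submodule.span F (w '' {μ | Dominates μ ν ∧ μ ≠ ν}) := by
  congr 2
  ext μ
  exact (lt_iff_le_and_ne (a := ν) (b := μ)).trans (and_congr_right fun _ => ne_comm)

theorem exists_orthogonalization (n : ℕ) :
    ∃ Q : n.Partition → Sym, IsOrthogonalization form q Q := by
  obtain ⟨T, τ, h1, h2, h3⟩ := exists_separating_operator n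
  exact exists_isOrthogonalization (fun ν => by rw [span_Ioi_eq]; exact h1 ν) h2 h3

/-- The orthogonalization of the family `q_μ`, that is the dual Jack functions. -/
noncomputable def dualJack {n : ℕ} : n.Partition → Sym :=
  Classical.choose (exists_orthogonalization n)

theorem isOrthogonalization_dualJack (n : ℕ) :
    IsOrthogonalization form (q : n.Partition → Sym) dualJack :=
  Classical.choose_spec (exists_orthogonalization n)

theorem D_triangular {n : ℕ} (ν : n.Partition) :
    D (q ν) - e ν • q ν ∈ Submodule.span F (q '' Set.Ioi ν) := by
  rw [span_Ioi_eq, D_eq_ham]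
  exact ham_one_q_sub_mem ν

theorem form_D (f g : Sym) : form (D f) g = form f (D g) := by
  rw [D_eq_ham, D_eq_ham, form_ham]

/-- Membership in a span, as the existence of a unitriangular expansion. -/
theorem sub_mem_span_iff {ι V K : Type*} [Field K] [AddCommGroup V] [Module K V] [Fintype ι]
    (w : ι → V) (s : ι → Prop) [DecidablePred s] (i : ι) (hi : s i) (x : V) :
    x - w i ∈ Submodule.span K (w '' {j | s j ∧ j ≠ i}) ↔
      ∃ C : ι → K, C i = 1 ∧ x = ∑ j with s j, C j • w j := by
  classical
  constructor
  · intro h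
    have hsub : ∀ y ∈ Submodule.span K (w '' {j | s j ∧ j ≠ i}),
        ∃ C : ι → K, C i = 0 ∧ y = ∑ j with s j, C j • w j := by
      intro y hy
      induction hy using Submodule.span_induction with
      | mem y hy =>
        obtain ⟨j, ⟨hj, hne⟩, rfl⟩ := hy
        refine ⟨Pi.single j 1, Pi.single_eq_of_ne hne.symm _, ?_⟩
        rw [Finset.sum_eq_single_of_mem j (by simpa using hj)]
        · rw [Pi.single_eq_same, one_smul]
        · intro k _ hk
          rw [Pi.single_eq_of_ne hk, zero_smul]
      | zero => exact ⟨0, rfl, by simp⟩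
      | add y z _ _ hy hz =>
        obtain ⟨C, hC, rfl⟩ := hy
        obtain ⟨C', hC', rfl⟩ := hz
        refine ⟨C + C', by simp [hC, hC'], ?_⟩
        simp only [Pi.add_apply, add_smul, Finset.sum_add_distrib]
      | smul a y _ hy =>
        obtain ⟨C, hC, rfl⟩ := hy
        refine ⟨a • C, by simp [hC], ?_⟩
        simp only [Pi.smul_apply, smul_eq_mul, mul_smul, Finset.smul_sum]
    obtain ⟨C, hC, hx⟩ := hsub _ h
    refine ⟨C + Pi.single i 1, by simp [hC], ?_⟩
    rw [sub_eq_iff_eq_add] at hx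
    simp only [Pi.add_apply, add_smul, Finset.sum_add_distrib]
    rw [hx, Finset.sum_eq_single_of_mem (f := fun j => (Pi.single i 1 : ι → K) j • w j) i
      (by simpa using hi)]
    · rw [Pi.single_eq_same, one_smul]
    · intro k _ hk
      rw [Pi.single_eq_of_ne hk, zero_smul]
  · rintro ⟨C, hC, rfl⟩
    have hmem : i ∈ Finset.univ.filter s := by simpa using hi
    rw [← Finset.add_sum_erase _ _ hmem, hC, one_smul, add_sub_cancel_left]
    refine Submodule.sum_mem _ fun j hj => Submodule.smul_mem _ _ (Submodule.subset_span ⟨j, ?_, rfl⟩)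
    rw [Finset.mem_erase, Finset.mem_filter] at hj
    exact ⟨hj.2.2, hj.1⟩

/-- The Jack functions obtained by rescaling the dual Jack functions. -/
noncomputable def jack (μ : Ptn) : Sym := (form (dualJack μ.2) (dualJack μ.2))⁻¹ • dualJack μ.2

theorem isWeightedHomogeneous_dualJack {n : ℕ} (μ : n.Partition) :
    MvPolynomial.IsWeightedHomogeneous pDeg (dualJack μ) n :=
  isWeightedHomogeneous_of_mem_qSpan ((isOrthogonalization_dualJack n).mem_range μ)

theorem form_dualJack {μ ν : Ptn} (h : μ ≠ ν) : form (dualJack μ.2) (dualJack ν.2) = 0 := by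
  obtain ⟨m, μ⟩ := μ
  obtain ⟨n, ν⟩ := ν
  by_cases hmn : m = n
  · subst hmn
    exact (isOrthogonalization_dualJack m).ortho μ ν fun hc => h (by rw [hc])
  · exact form_eq_zero_of_ne hmn (isWeightedHomogeneous_dualJack μ)
      (isWeightedHomogeneous_dualJack ν)

/-- Injectivity of `toSeries` moves the expansion in monomial functions into the polynomial ring,
where the abstract orthogonalization applies. -/
theorem toSeries_eq_sum_iff (μ : Ptn) (f : Sym) :
    (∃ c : μ.1.Partition → F, c μ.2 = 1 ∧
      toSeries f = ∑ ν with Dominates μ.2 ν, c ν • monomialSymm ν) ↔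
    f - mono μ.2 ∈ Submodule.span F (mono '' Set.Iio μ.2) := by
  have hs : Set.Iio μ.2 = {ν | Dominates μ.2 ν ∧ ν ≠ μ.2} := by
    ext ν
    exact lt_iff_le_and_ne (a := ν) (b := μ.2)
  rw [hs, sub_mem_span_iff mono (fun ν => Dominates μ.2 ν) μ.2 fun _ => le_rfl]
  refine exists_congr fun c => and_congr_right fun _ => ?_
  rw [← toSeries_injective.eq_iff, map_sum]
  simp only [map_smul, toSeries_mono]

theorem isJackFamily_jack : IsJackFamily jack := by
  refine ⟨fun μ => ?_, fun μ ν h => ?_⟩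
  · exact (toSeries_eq_sum_iff μ _).2
      ((isOrthogonalization_dualJack μ.1).inv_smul_sub_mem (dualFamilies μ.1) μ.2)
  · rw [← form_apply, jack, jack, map_smul, map_smul, LinearMap.smul_apply, form_dualJack h,
      smul_zero, smul_zero]

theorem eq_jack {P : Ptn → Sym} (hP : IsJackFamily P) : P = jack := by
  funext ⟨n, μ⟩
  exact (isOrthogonalization_dualJack n).eq_inv_smul (dualFamilies n)
    (P := fun ν => P ⟨n, ν⟩) (fun ν => (toSeries_eq_sum_iff ⟨n, ν⟩ _).1 (hP.1 ⟨n, ν⟩))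
    (fun ν κ h => hP.2 ⟨n, ν⟩ ⟨n, κ⟩ fun hc => h (by simpa using hc)) μ

theorem jackP_eq : jackP = jack := eq_jack (Classical.epsilon_spec ⟨jack, isJackFamily_jack⟩)

theorem form_dualJack_ne_zero {n : ℕ} (μ : n.Partition) : form (dualJack μ) (dualJack μ) ≠ 0 :=
  (isOrthogonalization_dualJack n).form_self_ne_zero (dualFamilies n) μ

/-- With `P = Q / ⟨Q, Q⟩` one has `⟨P, P⟩ = 1 / ⟨Q, Q⟩`, so dividing `P` by its norm returns `Q`. -/
theorem jackQ_eq (μ : Ptn) : jackQ μ = dualJack μ.2 := by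
  have h := form_dualJack_ne_zero μ.2
  rw [jackQ, jackP_eq, ← form_apply, jack, map_smul, map_smul, LinearMap.smul_apply, smul_smul]
  simp only [smul_eq_mul]
  rw [inv_mul_cancel₀ h, mul_one, inv_inv, mul_inv_cancel₀ h, one_smul]

end Jack

/-! ### Assembly of existence, uniqueness and the eigenvector characterization. -/

theorem theorem3p1 :
    (∃! P : Jack.Ptn → Jack.Sym, Jack.IsJackFamily P) ∧
    ∀ lam : Jack.Ptn,
      (∀ Q' : Jack.Sym, Q' = Jack.jackQ lam ↔
        (∃ C : lam.1.Partition → Jack.F, C lam.2 = 1 ∧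
          Q' = ∑ μ with Jack.Dominates μ lam.2, C μ • Jack.q μ) ∧
        (∃ c : Jack.F, Jack.D.HasEigenvector c Q')) ∧
      Jack.D (Jack.jackQ lam) = Jack.e lam.2 • Jack.jackQ lam := by
  refine ⟨⟨Jack.jack, Jack.isJackFamily_jack, fun P hP => Jack.eq_jack hP⟩, fun lam => ?_⟩
  have hd := Jack.dualFamilies lam.1
  have hQ := Jack.isOrthogonalization_dualJack lam.1
  have hD : Jack.D (Jack.dualJack lam.2) = Jack.e lam.2 • Jack.dualJack lam.2 :=
    hQ.map_eq_smul hd Jack.D_triangular Jack.form_D lam.2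
  rw [Jack.jackQ_eq]
  refine ⟨fun Q' => ?_, hD⟩
  rw [← Jack.sub_mem_span_iff Jack.q (fun μ => Jack.Dominates μ lam.2) lam.2 (fun _ => le_rfl),
    ← Jack.span_Ioi_eq]
  constructor
  · rintro rfl
    refine ⟨hQ.triangular lam.2, Jack.e lam.2, Module.End.hasEigenvector_iff.2
      ⟨Module.End.mem_eigenspace_iff.2 hD, fun h0 => ?_⟩⟩
    apply Jack.form_dualJack_ne_zero lam.2
    rw [h0, map_zero]
  · rintro ⟨h1, c, hc⟩
    -- Only eigenvalues at partitions strictly above `lam` must differ from that of `lam`, so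
    -- coincidences at incomparable partitions do no harm.
    exact hQ.eq_of_eigenvector hd Jack.D_triangular Jack.form_D
      (fun μ hμ => Jack.e_ne hμ.le hμ.ne') h1 hc.apply_eq_smul
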